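/- Let $d_A,d_B,k\ge 1$ be integers, $d=d_Ad_B$, and $\mathcal H=\mathbb C^{d_A}\otimes\mathbb C^{d_B}$. Let $\mathcal D(\mathcal H)$ be the set of density matrices (positive semidefinite, trace one) on $\mathcal H$, and let $\mathrm{SEP}\subset\mathcal D(\mathcal H)$ be the set of separable states, i.e. the convex hull of the product states $\rho_A\otimes\rho_B$. Let $\pi_{d,k}$ be the distribution of $\rho=\mathrm{tr}_R|\phi\rangle\langle\phi|$, where $\phi$ is a uniformly distributed unit vector of $\mathcal H\otimes\mathcal H_R$ and $\dim\mathcal H_R=k$. For a finite family $\mathcal O=(O_i)$ of observables (Hermitian matrices on $\mathcal H$) and a state $\rho$ let $$F_{\mathcal O}(\rho)=\{\sigma\in\mathcal D(\mathcal H) : \mathrm{tr}(O_i\sigma)=\mathrm{tr}(O_i\rho)\text{ for all } i\}$$ be the set of states consistent with the expectation values of $\mathcal O$ in $\rho$. The single-copy criterion given by $\mathcal O$ declares $\rho$ entangled exactly when $F_{\mathcal O}(\rho)\cap\mathrm{SEP}=\varnothing$; its detection capability is $$\mathcal C^s_k(\mathcal O)=\Pr_{\rho\sim\pi_{d,k}}\left[F_{\mathcal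 O}(\rho)\cap\mathrm{SEP}=\varnothing\right].$$ Then: 1. For every integer $M\ge 1$, every family $\mathcal O$ of $M-1$ observables and every $0<\varepsilon<1$, $$\mathcal C^s_k(\mathcal O)<2\,e^{C_1-C_2k},\qquad C_1=M\ln\frac{2\sqrt M\,d}{\varepsilon},\quad C_2=\left(\sqrt{2-\varepsilon}-1\right)^2 .$$ 2. In particular ($\varepsilon=1/2$), $\mathcal C^s_k(\mathcal O)<2\,e^{C_1-C_2k}$ with $C_1=M\ln(4\sqrt M\,d)$ and $C_2=(\sqrt{1.5}-1)^2$. 3. Detection needs $\Omega(k/\ln k)$ observables, or else the success probability is $e^{-\Omega(k)}$: there are absolute constants $c,c'>0$ and $k_0\ge 2$ such that for all $d_A,d_B\ge 1$, all $k\ge k_0$ and every finite family $\mathcal O$ of $m$ observables, either $m\ge c\,k/\ln k$ or $\mathcal C^s_k(\mathcal O)\le e^{-c'k}$. -/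

import Mathlib

open scoped ComplexOrder Kronecker

/-- The Borel (entrywise product) σ-algebra on complex matrices. -/
noncomputable instance matrixMeasurableSpace (ι κ : Type*) : MeasurableSpace (Matrix ι κ ℂ) :=
  MeasurableSpace.pi (X := fun _ : ι => κ → ℂ)

/-- Density matrices: positive semidefinite matrices of trace one. -/
def densityMatrices (ι : Type*) [Fintype ι] : Set (Matrix ι ι ℂ) :=
  {ρ | ρ.PosSemidef ∧ ρ.trace = 1}

/-- The separable states of `ℂ^α ⊗ ℂ^β`: convex combinations of product states. -/
def separableStates (α β : Type*) [Fintype α] [Fintype β] :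
    Set (Matrix (α × β) (α × β) ℂ) :=
  convexHull ℝ {τ | ∃ ρ ∈ densityMatrices α, ∃ σ ∈ densityMatrices β, τ = ρ ⊗ₖ σ}

/-- The unit sphere of `ℂ^ι`, i.e. the state vectors of pure states. -/
abbrev unitVectors (ι : Type*) [Fintype ι] : Type _ :=
  Metric.sphere (0 : EuclideanSpace ℂ ι) 1

/-- The uniform probability distribution on the unit sphere of `ℂ^ι`
(normalized surface measure). -/
noncomputable def uniformPureState (ι : Type*) [Fintype ι] :
    MeasureTheory.Measure (unitVectors ι) :=
  ((MeasureTheory.volume : MeasureTheory.Measure (EuclideanSpace ℂ ι)).toSphere Set.univ)⁻¹ •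
    (MeasureTheory.volume : MeasureTheory.Measure (EuclideanSpace ℂ ι)).toSphere

/-- The projector `|φ⟩⟨φ|`. -/
def pureProjector {ι : Type*} [Fintype ι] (φ : unitVectors ι) : Matrix ι ι ℂ :=
  Matrix.of fun i j => φ.1 i * star (φ.1 j)

/-- The partial trace over the second tensor factor. -/
def partialTraceSnd {ι κ : Type*} [Fintype κ] (X : Matrix (ι × κ) (ι × κ) ℂ) : Matrix ι ι ℂ :=
  Matrix.of fun i j => ∑ l, X (i, l) (j, l)

/-- The distribution of `tr_R |φ⟩⟨φ|` for a uniformly random unit vector `φ` of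
`ℂ^ι ⊗ ℂ^κ`, where `R` is the factor `ℂ^κ`; with `|ι| = d`, `|κ| = k` this is `π_{d,k}`. -/
noncomputable def inducedDistribution (ι κ : Type*) [Fintype ι] [Fintype κ] :
    MeasureTheory.Measure (Matrix ι ι ℂ) :=
  (uniformPureState (ι × κ)).map fun φ => partialTraceSnd (pureProjector φ)

/-- The states with the same expectation values as `ρ` for all observables `O i`. -/
def feasibleRegion {ι : Type*} [Fintype ι] {m : ℕ} (O : Fin m → Matrix ι ι ℂ)
    (ρ : Matrix ι ι ℂ) : Set (Matrix ι ι ℂ) :=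
  {σ | σ ∈ densityMatrices ι ∧ ∀ i, (O i * σ).trace = (O i * ρ).trace}

/-- The detection capability of the single-copy criterion given by the observables `O i`: the
probability that a random state of `ℂ^a ⊗ ℂ^b`, induced by an environment of dimension `k`, has a
feasible region that is disjoint from the set of separable states. -/
noncomputable def detectionCapability {a b m : ℕ} (k : ℕ)
    (O : Fin m → Matrix (Fin a × Fin b) (Fin a × Fin b) ℂ) : ℝ :=
  (inducedDistribution (Fin a × Fin b) (Fin k)).real
    {ρ | feasibleRegion O ρ ∩ separableStates (Fin a) (Fin b) = ∅}

/-!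
A single-copy criterion that detects `ρ` yields, by separating the point of expectation values of
`ρ` from the compact convex set of those of the separable states, a witness `W` in the real span of
the observables and the identity with `tr (W ρ) < 0` and `W` nonnegative on product vectors
(`exists_blockPositive_of_feasibleRegion_inter_eq_empty`). So the capability is the probability that
some witness in an at most `M`-dimensional space is negative on `ρ`, and it is bounded by a tail
bound for one observable together with a union bound over a net.

*Witnesses have a large trace.* A block-positive `W` satisfies `tr W² ≤ (tr W)²`
(`Matrix.BlockPositive.re_trace_mul_self_le`). For a vector `v` of the second factor the compression
`⟨v|W|v⟩` is positive semidefinite, so `tr ⟨v|W|v⟩² ≤ (tr ⟨v|W|v⟩)²`. Averaging over the symmetric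
subspace gives `tr W² + tr W_A² ≤ (tr W)² + tr W_B²` for the partial traces `W_A`, `W_B`; adding the
same inequality with the factors exchanged cancels the partial traces.

*Tail bound.* If `tr H ≥ α √(tr H²)` then `tr (H ρ) ≤ 0` has probability at most
`exp (-(√(1 + α) - 1)² k)` (`uniformPureState_re_trace_nonpos_le`). The event is a cone condition
on the random pure state, so in polar coordinates its probability is that of a Gaussian vector, for
which Chernoff's method gives `det (1 + t H)⁻ᵏ`; this is estimated at `t = 1 - 1 / √(1 + α)` by
`log (1 + y) ≥ y / (1 + y)`.

*Nets.* In an orthonormal family `X₁, …, Xₙ` spanning the traceless parts of the observables, a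
witness of trace `d` is `1 + d ∑ wᵢ Xᵢ` with `∑ wᵢ² ≤ 1 - 1 / d`. A grid point `w'` near `w`, with
the identity component lowered a little, still detects `ρ` and keeps the trace ratio. For the
bound with constants in terms of `d`, the error `d ∑ (w'ᵢ - wᵢ) tr (Xᵢ ρ)` is controlled for every
state by Bessel's inequality. For the trade-off, which is uniform in `d`, the tail bound is first
applied to `1 / d ± Xᵢ`: off an exponentially small event `d |tr (Xᵢ ρ)| < 1`, so a grid whose
fineness depends on `n` alone suffices, and the union bound has `exp (O(n ln n))` terms.
-/

/-! ### Compactness of convex hulls; Hilbert–Schmidt norms -/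

/-- In finite dimension, Carathéodory's theorem presents the convex hull of a compact set as a
continuous image of a compact set. -/
theorem isCompact_convexHull_of_isCompact {E : Type*} [NormedAddCommGroup E] [NormedSpace ℝ E]
    [FiniteDimensional ℝ E] {s : Set E} (hs : IsCompact s) : IsCompact (convexHull ℝ s) := by
  classical
  rcases s.eq_empty_or_nonempty with rfl | ⟨x₀, hx₀⟩
  · simp
  set n := Module.finrank ℝ E + 1
  let f : (Fin n → ℝ) × (Fin n → E) → E := fun p => ∑ i, p.1 i • p.2 i
  have hf : Continuous f := by fun_prop
  have hc : IsCompact ((stdSimplex ℝ (Fin n)) ×ˢ (Set.univ.pi fun _ : Fin n => s)) :=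
    (isCompact_stdSimplex ℝ (Fin n)).prod (isCompact_univ_pi fun _ => hs)
  convert! hc.image hf
  apply Set.Subset.antisymm
  · intro x hx
    obtain ⟨ι, _, z, w, hz, hzi, hw, hw1, hx⟩ := eq_pos_convex_span_of_mem_convexHull hx
    have hcard : Fintype.card ι ≤ Fintype.card (Fin n) := by
      simpa [n] using hzi.card_le_finrank_succ.trans
        (Nat.succ_le_succ (Submodule.finrank_le _))
    obtain ⟨e⟩ := Function.Embedding.nonempty_of_card_le hcard
    refine ⟨(Function.extend e w 0, Function.extend e z fun _ => x₀), ⟨⟨?_, ?_⟩, ?_⟩, ?_⟩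
    · intro i
      by_cases h : ∃ j, e j = i
      · obtain ⟨j, rfl⟩ := h
        simpa [e.injective.extend_apply] using (hw j).le
      · simp [Function.extend_apply' _ _ _ h]
    · rw [← hw1]
      symm
      refine Fintype.sum_of_injective e e.injective _ _ ?_ ?_
      · intro i hi
        simp [Function.extend_apply' w (0 : Fin n → ℝ) i (by simpa using hi)]
      · intro j; simp [e.injective.extend_apply]
    · intro i _
      by_cases h : ∃ j, e j = i
      · obtain ⟨j, rfl⟩ := h
        simpa [e.injective.extend_apply] using hz ⟨j, rfl⟩
      · simpa [Function.extend_apply' _ _ _ h] using hx₀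
    · rw [← hx]
      symm
      refine Fintype.sum_of_injective e e.injective _ _ ?_ ?_
      · intro i hi
        simp [Function.extend_apply' w (0 : Fin n → ℝ) i (by simpa using hi)]
      · intro j; simp [e.injective.extend_apply]
  · rintro _ ⟨⟨w, z⟩, ⟨hw, hz⟩, rfl⟩
    exact (convex_convexHull ℝ s).sum_mem (fun i _ => hw.1 i) hw.2
      fun i _ => subset_convexHull ℝ s (hz i trivial)

namespace Matrix

variable {ι : Type*} [Fintype ι]

/-- The squared Hilbert–Schmidt norm of a Hermitian matrix in terms of its eigenvalues. -/
theorem IsHermitian.re_trace_mul_self [DecidableEq ι] {A : Matrix ι ι ℂ} (hA : A.IsHermitian) :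
    (A * A).trace.re = ∑ i, hA.eigenvalues i ^ 2 := by
  have h : A * A = (Unitary.conjStarAlgAut ℂ (Matrix ι ι ℂ)) hA.eigenvectorUnitary
      (diagonal fun i => (hA.eigenvalues i : ℂ) ^ 2) := by
    conv_lhs => rw [hA.spectral_theorem, ← map_mul, diagonal_mul_diagonal]
    simp [sq]
  rw [h, Unitary.conjStarAlgAut_apply, trace_mul_cycle]
  simp [trace_diagonal, ← Complex.ofReal_pow]

theorem IsHermitian.re_trace [DecidableEq ι] {A : Matrix ι ι ℂ} (hA : A.IsHermitian) :
    A.trace.re = ∑ i, hA.eigenvalues i := by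
  rw [hA.trace_eq_sum_eigenvalues]; simp

theorem PosSemidef.re_trace_mul_self_le {A : Matrix ι ι ℂ} (hA : A.PosSemidef) :
    (A * A).trace.re ≤ A.trace.re ^ 2 := by
  classical
  rw [hA.isHermitian.re_trace_mul_self, hA.isHermitian.re_trace]
  exact Finset.sum_sq_le_sq_sum_of_nonneg fun i _ => hA.eigenvalues_nonneg i

end Matrix

/-! ### Fourth moments of random phases -/

noncomputable instance : Fintype (rootsOfUnity 4 ℂ) := Fintype.ofFinite _

/-- Fourth moments of independent uniformly random fourth roots of unity. -/
theorem sum_rootsOfUnity_fourth_moment {β : Type*} [Fintype β] [DecidableEq β] (k l m n : β) :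
    ∑ θ : β → rootsOfUnity 4 ℂ,
        star ((θ k : ℂˣ) : ℂ) * ((θ l : ℂˣ) : ℂ) * (star ((θ m : ℂˣ) : ℂ) * ((θ n : ℂˣ) : ℂ)) =
      Fintype.card (β → rootsOfUnity 4 ℂ) *
        (if (k = l ∧ m = n) ∨ (k = n ∧ l = m) then 1 else 0) := by
  have hz : ∀ z : rootsOfUnity 4 ℂ, star ((z : ℂˣ) : ℂ) * ((z : ℂˣ) : ℂ) = 1 := by
    intro z
    have := Complex.norm_eq_one_of_mem_rootsOfUnity z.2
    simp [Complex.conj_mul', this]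
  split_ifs with h
  · have : ∀ θ : β → rootsOfUnity 4 ℂ,
        star ((θ k : ℂˣ) : ℂ) * ((θ l : ℂˣ) : ℂ) * (star ((θ m : ℂˣ) : ℂ) * ((θ n : ℂˣ) : ℂ))
          = 1 := by
      intro θ
      rcases h with ⟨rfl, rfl⟩ | ⟨rfl, rfl⟩
      · rw [hz, hz, one_mul]
      · calc _ = (star ((θ k : ℂˣ) : ℂ) * ((θ k : ℂˣ) : ℂ)) *
              (star ((θ l : ℂˣ) : ℂ) * ((θ l : ℂˣ) : ℂ)) := by ring
          _ = 1 := by rw [hz, hz, one_mul]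
    simp only [this]
    simp
  · -- Multiplying the phase at one suitable index by `I` multiplies the sum by a number `≠ 1`.
    obtain ⟨I₄, hI⟩ : ∃ z : rootsOfUnity 4 ℂ, ((z : ℂˣ) : ℂ) = Complex.I :=
      ⟨⟨Units.mk0 Complex.I Complex.I_ne_zero, by
        rw [mem_rootsOfUnity]; ext; simp [Complex.I_pow_four]⟩, rfl⟩
    have key : ∀ g : β → rootsOfUnity 4 ℂ,
        star ((g k : ℂˣ) : ℂ) * ((g l : ℂˣ) : ℂ) * (star ((g m : ℂˣ) : ℂ) * ((g n : ℂˣ) : ℂ)) ≠ 1 →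
        ∑ θ : β → rootsOfUnity 4 ℂ, star ((θ k : ℂˣ) : ℂ) * ((θ l : ℂˣ) : ℂ) *
          (star ((θ m : ℂˣ) : ℂ) * ((θ n : ℂˣ) : ℂ)) = 0 := by
      intro g hg
      have h1 := Fintype.sum_equiv (Equiv.mulLeft g)
        (fun θ : β → rootsOfUnity 4 ℂ => star (((g * θ) k : ℂˣ) : ℂ) * (((g * θ) l : ℂˣ) : ℂ) *
          (star (((g * θ) m : ℂˣ) : ℂ) * (((g * θ) n : ℂˣ) : ℂ)))
        (fun θ : β → rootsOfUnity 4 ℂ => star ((θ k : ℂˣ) : ℂ) * ((θ l : ℂˣ) : ℂ) *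
          (star ((θ m : ℂˣ) : ℂ) * ((θ n : ℂˣ) : ℂ))) (fun θ => rfl)
      rw [← sub_eq_zero] at h1
      have h2 : (star ((g k : ℂˣ) : ℂ) * ((g l : ℂˣ) : ℂ) *
          (star ((g m : ℂˣ) : ℂ) * ((g n : ℂˣ) : ℂ)) - 1) *
          ∑ θ : β → rootsOfUnity 4 ℂ, star ((θ k : ℂˣ) : ℂ) * ((θ l : ℂˣ) : ℂ) *
          (star ((θ m : ℂˣ) : ℂ) * ((θ n : ℂˣ) : ℂ)) = 0 := by
        rw [← h1, sub_mul, one_mul, Finset.mul_sum]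
        congr 1
        refine Finset.sum_congr rfl fun θ _ => ?_
        simp only [Pi.mul_apply, Subgroup.coe_mul, Units.val_mul, star_mul']
        ring
      exact (mul_eq_zero.mp h2).resolve_left (sub_ne_zero.mpr hg)
    have hval : ∀ b c : β, (((Pi.mulSingle b I₄ : β → rootsOfUnity 4 ℂ) c : ℂˣ) : ℂ) =
        if c = b then Complex.I else 1 := by
      intro b c
      by_cases hc : c = b
      · subst hc; simp [hI]
      · simp [hc]
    have hI1 : Complex.I ≠ 1 := fun h => by simpa using congrArg Complex.re h
    have hI2 : -Complex.I ≠ 1 := fun h => by simpa using congrArg Complex.re h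
    have hI3 : (-1 : ℂ) ≠ 1 := by norm_num
    rw [mul_zero]
    by_cases hc : star (((Pi.mulSingle k I₄ : β → rootsOfUnity 4 ℂ) k : ℂˣ) : ℂ) *
        (((Pi.mulSingle k I₄ : β → rootsOfUnity 4 ℂ) l : ℂˣ) : ℂ) *
        (star (((Pi.mulSingle k I₄ : β → rootsOfUnity 4 ℂ) m : ℂˣ) : ℂ) *
        (((Pi.mulSingle k I₄ : β → rootsOfUnity 4 ℂ) n : ℂˣ) : ℂ)) = 1
    · refine key (Pi.mulSingle m I₄) ?_
      simp only [hval, apply_ite star, star_one, Complex.star_def, Complex.conj_I] at hc ⊢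
      have hII := Complex.I_mul_I
      grind
    · exact key _ hc

namespace Matrix

/-- The phase vectors together with the standard basis vectors average the product of two
quadratic forms over the symmetric subspace. -/
theorem sum_rootsOfUnity_quadraticForm_mul {β : Type*} [Fintype β] [DecidableEq β]
    (C D : Matrix β β ℂ) :
    ∑ θ : β → rootsOfUnity 4 ℂ,
        (∑ k, ∑ l, star ((θ k : ℂˣ) : ℂ) * C k l * ((θ l : ℂˣ) : ℂ)) *
        (∑ m, ∑ n, star ((θ m : ℂˣ) : ℂ) * D m n * ((θ n : ℂˣ) : ℂ)) =
      Fintype.card (β → rootsOfUnity 4 ℂ) *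
        (C.trace * D.trace + (C * D).trace - ∑ k, C k k * D k k) := by
  have h1 : ∀ θ : β → rootsOfUnity 4 ℂ,
      (∑ k, ∑ l, star ((θ k : ℂˣ) : ℂ) * C k l * ((θ l : ℂˣ) : ℂ)) *
        (∑ m, ∑ n, star ((θ m : ℂˣ) : ℂ) * D m n * ((θ n : ℂˣ) : ℂ)) =
      ∑ k, ∑ l, ∑ m, ∑ n, C k l * D m n * (star ((θ k : ℂˣ) : ℂ) * ((θ l : ℂˣ) : ℂ) *
        (star ((θ m : ℂˣ) : ℂ) * ((θ n : ℂˣ) : ℂ))) := by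
    intro θ
    simp only [Finset.sum_mul]
    simp only [Finset.mul_sum]
    refine Finset.sum_congr rfl fun k _ => Finset.sum_congr rfl fun l _ =>
      Finset.sum_congr rfl fun m _ => Finset.sum_congr rfl fun n _ => by ring
  have h2 : ∀ k l m n : β,
      (if (k = l ∧ m = n) ∨ (k = n ∧ l = m) then (1 : ℂ) else 0) =
        (if l = k then if n = m then 1 else 0 else 0) +
        (if m = l then if n = k then 1 else 0 else 0) -
        (if l = k then if m = l then if n = k then 1 else 0 else 0 else 0) := by
    intro k l m n
    clear h1
    grind
  simp only [h1]
  have h3 : ∀ k l m n : β, ∑ θ : β → rootsOfUnity 4 ℂ,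
      C k l * D m n * (star ((θ k : ℂˣ) : ℂ) * ((θ l : ℂˣ) : ℂ) *
        (star ((θ m : ℂˣ) : ℂ) * ((θ n : ℂˣ) : ℂ))) =
      Fintype.card (β → rootsOfUnity 4 ℂ) * (C k l * D m n *
        ((if l = k then if n = m then 1 else 0 else 0) +
        (if m = l then if n = k then 1 else 0 else 0) -
        (if l = k then if m = l then if n = k then 1 else 0 else 0 else 0))) := by
    intro k l m n
    rw [← Finset.mul_sum, sum_rootsOfUnity_fourth_moment, h2]
    generalize (Fintype.card (β → rootsOfUnity 4 ℂ) : ℂ) = N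
    ring
  refine (Finset.sum_comm.trans (Finset.sum_congr rfl fun k _ => Finset.sum_comm.trans
    (Finset.sum_congr rfl fun l _ => Finset.sum_comm.trans (Finset.sum_congr rfl fun m _ =>
      Finset.sum_comm.trans (Finset.sum_congr rfl fun n _ => h3 k l m n))))).trans ?_
  generalize (Fintype.card (β → rootsOfUnity 4 ℂ) : ℂ) = N
  simp only [← Finset.mul_sum]
  congr 1
  simp only [mul_add, mul_sub, Finset.sum_add_distrib, Finset.sum_sub_distrib, mul_ite, mul_one,
    mul_zero, Finset.sum_ite_eq', Finset.mem_univ, if_true,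
    Finset.sum_ite_irrel, Finset.sum_const_zero]
  simp only [trace, mul_apply, diag_apply, Finset.sum_mul, Finset.mul_sum]
  congr 2
  exact Finset.sum_comm

end Matrix

/-! ### Block-positive matrices: `tr W² ≤ (tr W)²` -/

namespace Matrix

variable {α β : Type*} [Fintype α] [Fintype β]

/-- The compression `⟨v|W|v⟩` of a bipartite matrix to the first factor by a vector `v` of the
second one. -/
def compression (W : Matrix (α × β) (α × β) ℂ) (v : β → ℂ) : Matrix α α ℂ :=
  of fun i j => ∑ k, ∑ l, star (v k) * W (i, k) (j, l) * v l

/-- A bipartite matrix whose quadratic form is nonnegative on product vectors (an entanglement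
witness, up to the requirement that it be negative somewhere). -/
def BlockPositive (W : Matrix (α × β) (α × β) ℂ) : Prop :=
  W.IsHermitian ∧ ∀ (a : α → ℂ) (b : β → ℂ),
    0 ≤ (star (fun p : α × β => a p.1 * b p.2) ⬝ᵥ W *ᵥ fun p : α × β => a p.1 * b p.2).re

theorem dotProduct_mulVec_product (W : Matrix (α × β) (α × β) ℂ) (a : α → ℂ) (b : β → ℂ) :
    (star (fun p : α × β => a p.1 * b p.2) ⬝ᵥ W *ᵥ fun p : α × β => a p.1 * b p.2) =
      star a ⬝ᵥ compression W b *ᵥ a := by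
  simp only [dotProduct, mulVec, compression, Pi.star_apply, of_apply, Fintype.sum_prod_type,
    Finset.mul_sum, Finset.sum_mul, star_mul']
  refine Finset.sum_congr rfl fun i _ => ?_
  rw [Finset.sum_comm]
  refine Finset.sum_congr rfl fun j _ => Finset.sum_congr rfl fun k _ =>
    Finset.sum_congr rfl fun l _ => by ring

theorem BlockPositive.posSemidef_compression {W : Matrix (α × β) (α × β) ℂ}
    (hW : W.BlockPositive) (v : β → ℂ) : (compression W v).PosSemidef := by
  have hH : (compression W v).IsHermitian := by
    ext i j
    simp only [conjTranspose_apply, compression, of_apply, star_sum, star_mul', star_star]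
    rw [Finset.sum_comm]
    refine Finset.sum_congr rfl fun k _ => Finset.sum_congr rfl fun l _ => ?_
    rw [← hW.1.apply (i, k) (j, l)]
    ring
  refine PosSemidef.of_dotProduct_mulVec_nonneg hH fun x => ?_
  rw [Complex.nonneg_iff]
  exact ⟨by rw [← dotProduct_mulVec_product]; exact hW.2 x v,
    (hH.im_star_dotProduct_mulVec_self x).symm⟩

theorem BlockPositive.swap {W : Matrix (α × β) (α × β) ℂ} (hW : W.BlockPositive) :
    (W.submatrix Prod.swap Prod.swap).BlockPositive := by
  refine ⟨hW.1.submatrix _, fun b a => ?_⟩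
  convert hW.2 a b using 2
  simp only [dotProduct, mulVec, Fintype.sum_prod_type, Pi.star_apply, submatrix_apply,
    Prod.swap_prod_mk, star_mul']
  rw [Finset.sum_comm]
  refine Finset.sum_congr rfl fun i _ => Finset.sum_congr rfl fun k _ => ?_
  rw [Finset.sum_comm]
  congr 1
  · ring
  · refine Finset.sum_congr rfl fun i _ => Finset.sum_congr rfl fun k _ => by ring

/-- With `W_A`, `W_B` the two partial traces, `tr W² + tr W_A² ≤ (tr W)² + tr W_B²`: average
`tr (⟨v|W|v⟩²) ≤ (tr ⟨v|W|v⟩)²` over random phase vectors `v` and add the cases where `v` is a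
standard basis vector. -/
theorem BlockPositive.re_trace_add_le [DecidableEq β] {W : Matrix (α × β) (α × β) ℂ}
    (hW : W.BlockPositive) :
    (W * W).trace.re + (∑ i, ∑ j, (∑ k, W (i, k) (j, k)) * ∑ k, W (j, k) (i, k)).re ≤
      W.trace.re ^ 2 + (∑ k, ∑ l, (∑ i, W (i, k) (i, l)) * ∑ i, W (i, l) (i, k)).re := by
  have hreal : ∀ v : β → ℂ,
      ((compression W v * compression W v).trace).re ≤
        ((compression W v).trace * (compression W v).trace).re := by
    intro v
    have h1 := (hW.posSemidef_compression v).re_trace_mul_self_le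
    have h2 : (compression W v).trace.im = 0 :=
      (Complex.nonneg_iff.1 (hW.posSemidef_compression v).trace_nonneg).2.symm
    simpa [Complex.mul_re, h2, sq] using h1
  let C : α → α → Matrix β β ℂ := fun i j => of fun k l => W (i, k) (j, l)
  have hN : (0 : ℝ) < Fintype.card (β → rootsOfUnity 4 ℂ) := by
    exact_mod_cast Fintype.card_pos
  have hphase := Finset.sum_le_sum fun (θ : β → rootsOfUnity 4 ℂ) (_ : θ ∈ Finset.univ) =>
    hreal fun k => ((θ k : ℂˣ) : ℂ)
  have hbasis := Finset.sum_le_sum fun (k : β) (_ : k ∈ Finset.univ) =>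
    hreal (Pi.single k 1)
  have hL : ∑ θ : β → rootsOfUnity 4 ℂ, ((compression W fun k => ((θ k : ℂˣ) : ℂ)) *
      (compression W fun k => ((θ k : ℂˣ) : ℂ))).trace =
      Fintype.card (β → rootsOfUnity 4 ℂ) * ∑ i, ∑ j, ((C i j).trace * (C j i).trace +
        (C i j * C j i).trace - ∑ k, C i j k k * C j i k k) := by
    have htr : ∀ A : Matrix α α ℂ, (A * A).trace = ∑ i, ∑ j, A i j * A j i := fun A => rfl
    simp only [htr]
    rw [Finset.sum_comm, Finset.mul_sum]
    refine Finset.sum_congr rfl fun i _ => ?_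
    rw [Finset.sum_comm, Finset.mul_sum]
    exact Finset.sum_congr rfl fun j _ => sum_rootsOfUnity_quadraticForm_mul (C i j) (C j i)
  have hR : ∑ θ : β → rootsOfUnity 4 ℂ, (compression W fun k => ((θ k : ℂˣ) : ℂ)).trace *
      (compression W fun k => ((θ k : ℂˣ) : ℂ)).trace =
      Fintype.card (β → rootsOfUnity 4 ℂ) * ∑ i, ∑ j, ((C i i).trace * (C j j).trace +
        (C i i * C j j).trace - ∑ k, C i i k k * C j j k k) := by
    have htr : ∀ A : Matrix α α ℂ, A.trace * A.trace = ∑ i, ∑ j, A i i * A j j :=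
      fun A => Finset.sum_mul_sum _ _ _ _
    simp only [htr]
    rw [Finset.sum_comm, Finset.mul_sum]
    refine Finset.sum_congr rfl fun i _ => ?_
    rw [Finset.sum_comm, Finset.mul_sum]
    exact Finset.sum_congr rfl fun j _ => sum_rootsOfUnity_quadraticForm_mul (C i i) (C j j)
  have hsingle : ∀ k i j, compression W (Pi.single k 1) i j = C i j k k := by
    intro k i j
    simp [compression, C, Pi.single_apply]
  simp only [trace, mul_apply, diag_apply, hsingle, Finset.sum_mul_sum] at hbasis
  rw [← Complex.re_sum, ← Complex.re_sum, hL, hR, ← Complex.ofReal_natCast,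
    Complex.re_ofReal_mul, Complex.re_ofReal_mul] at hphase
  have hphase := le_of_mul_le_mul_left hphase hN
  rw [← Complex.re_sum, ← Complex.re_sum] at hbasis
  simp only [Finset.sum_add_distrib, Finset.sum_sub_distrib, Complex.add_re, Complex.sub_re]
    at hphase
  have e1 : (W * W).trace = ∑ i, ∑ j, (C i j * C j i).trace := by
    simp only [trace, mul_apply, diag_apply, Fintype.sum_prod_type, C, of_apply]
    refine Finset.sum_congr rfl fun i _ => Finset.sum_comm
  have e2 : ∑ k, ∑ l, (∑ i, W (i, k) (i, l)) * ∑ i, W (i, l) (i, k) =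
      ∑ i, ∑ j, (C i i * C j j).trace := by
    simp only [trace, mul_apply, diag_apply, Finset.sum_mul_sum, C, of_apply]
    calc _ = ∑ k, ∑ i, ∑ l, ∑ j, W (i, k) (i, l) * W (j, l) (j, k) :=
          Finset.sum_congr rfl fun k _ => Finset.sum_comm
      _ = ∑ i, ∑ k, ∑ l, ∑ j, W (i, k) (i, l) * W (j, l) (j, k) := Finset.sum_comm
      _ = ∑ i, ∑ k, ∑ j, ∑ l, W (i, k) (i, l) * W (j, l) (j, k) :=
          Finset.sum_congr rfl fun i _ => Finset.sum_congr rfl fun k _ => Finset.sum_comm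
      _ = _ := Finset.sum_congr rfl fun i _ => Finset.sum_comm
  have e3 : W.trace.re ^ 2 = (∑ i, ∑ j, (C i i).trace * (C j j).trace).re := by
    have him : W.trace.im = 0 := by
      classical rw [hW.1.trace_eq_sum_eigenvalues]; simp
    rw [← Finset.sum_mul_sum]
    have : W.trace = ∑ i, (C i i).trace := by
      simp [trace, C, Fintype.sum_prod_type]
    rw [← this, Complex.mul_re, him]; ring
  have e4 : (∑ k, ∑ i, ∑ j, C i j k k * C j i k k) =
      ∑ i, ∑ j, ∑ k, C i j k k * C j i k k := by
    rw [Finset.sum_comm]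
    exact Finset.sum_congr rfl fun i _ => Finset.sum_comm
  have e5 : (∑ k, ∑ i, ∑ j, C i i k k * C j j k k) =
      ∑ i, ∑ j, ∑ k, C i i k k * C j j k k := by
    rw [Finset.sum_comm]
    exact Finset.sum_congr rfl fun i _ => Finset.sum_comm
  rw [e4, e5] at hbasis
  rw [e1, e2, e3]
  have e6 : (∑ i, ∑ j, (∑ k, W (i, k) (j, k)) * ∑ k, W (j, k) (i, k)) =
    ∑ i, ∑ j, (C i j).trace * (C j i).trace := rfl
  rw [e6]
  linarith

/-- The Hilbert–Schmidt norm of a block-positive matrix is at most its trace: in the sum of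
`re_trace_add_le` for `W` and for `W` with exchanged factors the partial traces cancel. -/
theorem BlockPositive.re_trace_mul_self_le {W : Matrix (α × β) (α × β) ℂ}
    (hW : W.BlockPositive) : (W * W).trace.re ≤ W.trace.re ^ 2 := by
  classical
  have h1 := hW.re_trace_add_le
  have h2 := hW.swap.re_trace_add_le
  have e1 : (W.submatrix Prod.swap Prod.swap).trace = W.trace := by
    simp only [trace, Fintype.sum_prod_type, diag_apply, submatrix_apply, Prod.swap_prod_mk]
    exact Finset.sum_comm
  have e2 : (W.submatrix Prod.swap Prod.swap * W.submatrix Prod.swap Prod.swap).trace =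
      (W * W).trace := by
    have := submatrix_mul_equiv W W Prod.swap (Equiv.prodComm β α) Prod.swap
    simp only [Equiv.coe_prodComm] at this
    rw [this]
    simp only [trace, Fintype.sum_prod_type, diag_apply, submatrix_apply, Prod.swap_prod_mk]
    exact Finset.sum_comm
  rw [e1, e2] at h2
  simp only [submatrix_apply, Prod.swap_prod_mk] at h2
  linarith

end Matrix

/-! ### Polar coordinates and reduced states -/

open MeasureTheory in
/-- Integration in polar coordinates. -/
theorem lintegral_eq_lintegral_toSphere {E : Type*} [NormedAddCommGroup E] [NormedSpace ℝ E]
    [FiniteDimensional ℝ E] [Nontrivial E] [MeasurableSpace E] [BorelSpace E] (μ : Measure E)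
    [μ.IsAddHaarMeasure] {F : E → ENNReal} (hF : Measurable F) :
    ∫⁻ x, F x ∂μ = ∫⁻ u : Metric.sphere (0 : E) 1, ∫⁻ r : Set.Ioi (0 : ℝ),
      F (r.1 • u.1) ∂(Measure.volumeIoiPow (Module.finrank ℝ E - 1)) ∂μ.toSphere := by
  have h1 : ∫⁻ x, F x ∂μ = ∫⁻ x : ({(0 : E)}ᶜ : Set E), F x.1 ∂(μ.comap Subtype.val) := by
    rw [lintegral_subtype_comap (measurableSet_singleton (0 : E)).compl,
      restrict_compl_singleton]
  have hm : Measurable fun p : Metric.sphere (0 : E) 1 × Set.Ioi (0 : ℝ) => F (p.2.1 • p.1.1) :=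
    hF.comp (by fun_prop)
  rw [h1, ← lintegral_prod _ hm.aemeasurable,
    ← μ.measurePreserving_homeomorphUnitSphereProd.lintegral_comp hm]
  refine lintegral_congr fun x => ?_
  have hx : ‖x.1‖ ≠ 0 := norm_ne_zero_iff.2 x.2
  congr 1
  simp [smul_smul, hx]

open MeasureTheory in
/-- A tail bound on the sphere through a homogeneous extension: if `F` dominates the radial
function `g` on the cone over `s`, then the normalized surface measure of `s` is at most
`∫ F / ∫ g(‖x‖)`. -/
theorem toSphere_mul_lintegral_le {E : Type*} [NormedAddCommGroup E] [NormedSpace ℝ E]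
    [FiniteDimensional ℝ E] [Nontrivial E] [MeasurableSpace E] [BorelSpace E] (μ : Measure E)
    [μ.IsAddHaarMeasure] {s : Set (Metric.sphere (0 : E) 1)} (hs : MeasurableSet s)
    {g : ℝ → ENNReal} (hg : Measurable g) {F : E → ENNReal} (hF : Measurable F)
    (h : ∀ u ∈ s, ∀ r : ℝ, 0 < r → g r ≤ F (r • u.1)) :
    μ.toSphere s * ∫⁻ x, g ‖x‖ ∂μ ≤ μ.toSphere Set.univ * ∫⁻ x, F x ∂μ := by
  rw [lintegral_eq_lintegral_toSphere μ (F := fun x => g ‖x‖) (hg.comp measurable_norm)]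
  have h1 : ∀ (u : Metric.sphere (0 : E) 1) (r : Set.Ioi (0 : ℝ)), ‖r.1 • u.1‖ = r.1 := by
    intro u r
    rw [norm_smul, norm_eq_of_mem_sphere, mul_one, Real.norm_of_nonneg r.2.out.le]
  simp only [h1]
  rw [lintegral_const, mul_left_comm, mul_comm _ (μ.toSphere Set.univ), mul_left_comm]
  gcongr
  rw [lintegral_eq_lintegral_toSphere μ hF, ← setLIntegral_const]
  refine (setLIntegral_mono' hs fun u hu => ?_).trans (setLIntegral_le_lintegral s _)
  exact lintegral_mono fun r => h u hu r r.2

section Gaussian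

open MeasureTheory

variable {ι κ : Type*} [Fintype κ]

/-- The matrix `∑ l, |x_l⟩⟨x_l|` for `x = ∑ l, x_l ⊗ e_l`, i.e. the partial trace of `|x⟩⟨x|` for a
vector `x` that is not necessarily normalized. -/
def reducedMatrix (x : EuclideanSpace ℂ (ι × κ)) : Matrix ι ι ℂ :=
  Matrix.of fun i j => ∑ l, x (i, l) * star (x (j, l))

theorem partialTraceSnd_pureProjector [Fintype ι] (φ : unitVectors (ι × κ)) :
    partialTraceSnd (pureProjector φ) = reducedMatrix φ.1 := rfl

theorem reducedMatrix_eq_mul_conjTranspose (x : EuclideanSpace ℂ (ι × κ)) :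
    reducedMatrix x =
      (Matrix.of fun i l => x (i, l)) * (Matrix.of fun i l => x (i, l)).conjTranspose := by
  ext i j; simp [reducedMatrix, Matrix.mul_apply]

theorem posSemidef_reducedMatrix [Fintype ι] (x : EuclideanSpace ℂ (ι × κ)) :
    (reducedMatrix x).PosSemidef := by
  rw [reducedMatrix_eq_mul_conjTranspose]
  exact Matrix.posSemidef_self_mul_conjTranspose _

theorem trace_reducedMatrix [Fintype ι] (x : EuclideanSpace ℂ (ι × κ)) :
    (reducedMatrix x).trace = (‖x‖ ^ 2 : ℝ) := by
  rw [EuclideanSpace.norm_sq_eq, Fintype.sum_prod_type]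
  simp [reducedMatrix, Matrix.trace, Complex.mul_conj']

theorem partialTraceSnd_pureProjector_mem [Fintype ι] (φ : unitVectors (ι × κ)) :
    partialTraceSnd (pureProjector φ) ∈ densityMatrices ι := by
  rw [partialTraceSnd_pureProjector]
  exact ⟨posSemidef_reducedMatrix _, by rw [trace_reducedMatrix]; simp⟩

theorem reducedMatrix_smul (r : ℝ) (x : EuclideanSpace ℂ (ι × κ)) :
    reducedMatrix (r • x) = (r ^ 2) • reducedMatrix x := by
  ext i j
  simp [reducedMatrix, Finset.mul_sum]
  exact Finset.sum_congr rfl fun l _ => by ring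

theorem continuous_reducedMatrix :
    Continuous (reducedMatrix : EuclideanSpace ℂ (ι × κ) → Matrix ι ι ℂ) := by
  refine continuous_matrix fun i j => ?_
  simp only [reducedMatrix, Matrix.of_apply]
  fun_prop

variable [Fintype ι] [DecidableEq ι]

/-- The isomorphism `U ⊗ 1` from coordinate vectors onto the bipartite Hilbert space. -/
noncomputable def unitaryCoordinates (U : Matrix.unitaryGroup ι ℂ) (κ : Type*) [Fintype κ] :
    (ι × κ → ℂ) ≃L[ℝ] EuclideanSpace ℂ (ι × κ) :=
  LinearEquiv.toContinuousLinearEquiv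
  { toFun := fun y => WithLp.toLp 2 fun p => ∑ j, U.1 p.1 j * y (j, p.2)
    invFun := fun x p => ∑ j, (star U.1) p.1 j * x (j, p.2)
    map_add' := fun y z => by ext p; simp [mul_add, Finset.sum_add_distrib]
    map_smul' := fun r y => by
      ext p
      simp [Finset.mul_sum, mul_left_comm]
    left_inv := fun y => by
      ext p
      change (star U.1 * (U.1 * Matrix.of fun i l => y (i, l))) p.1 p.2 = y p
      rw [← Matrix.mul_assoc, Unitary.star_mul_self_of_mem U.2, Matrix.one_mul]
      rfl
    right_inv := fun x => by
      ext p
      change (U.1 * (star U.1 * Matrix.of fun i l => x (i, l))) p.1 p.2 = x p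
      rw [← Matrix.mul_assoc, Unitary.mul_star_self_of_mem U.2, Matrix.one_mul]
      rfl }

theorem reducedMatrix_unitaryCoordinates (U : Matrix.unitaryGroup ι ℂ) (y : ι × κ → ℂ) :
    reducedMatrix (unitaryCoordinates U κ y) = U.1 * ((Matrix.of fun i l => y (i, l)) *
        (Matrix.of fun i l => y (i, l)).conjTranspose) * star U.1 := by
  have h : (Matrix.of fun i l => unitaryCoordinates U κ y (i, l)) =
      U.1 * (Matrix.of fun i l => y (i, l)) := rfl
  rw [reducedMatrix_eq_mul_conjTranspose, h, Matrix.conjTranspose_mul,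
    Matrix.star_eq_conjTranspose]
  simp only [Matrix.mul_assoc]

theorem norm_sq_unitaryCoordinates (U : Matrix.unitaryGroup ι ℂ) (y : ι × κ → ℂ) :
    ‖unitaryCoordinates U κ y‖ ^ 2 = ∑ p, ‖y p‖ ^ 2 := by
  have h : ((‖unitaryCoordinates U κ y‖ ^ 2 : ℝ) : ℂ) = ((∑ p, ‖y p‖ ^ 2 : ℝ) : ℂ) := by
    rw [← trace_reducedMatrix, reducedMatrix_unitaryCoordinates, Matrix.trace_mul_cycle,
      Unitary.coe_star_mul_self, Matrix.one_mul, Fintype.sum_prod_type]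
    simp [Matrix.trace, Matrix.mul_apply, Complex.mul_conj']
  exact_mod_cast h

theorem re_trace_mul_reducedMatrix_unitaryCoordinates {H : Matrix ι ι ℂ} (hH : H.IsHermitian)
    (y : ι × κ → ℂ) :
    (H * reducedMatrix (unitaryCoordinates hH.eigenvectorUnitary κ y)).trace.re =
      ∑ p, hH.eigenvalues p.1 * ‖y p‖ ^ 2 := by
  have hs := hH.spectral_theorem
  rw [Unitary.conjStarAlgAut_apply] at hs
  generalize hH.eigenvectorUnitary = U at hs ⊢
  generalize hH.eigenvalues = lam at hs ⊢
  have h : H * reducedMatrix (unitaryCoordinates U κ y) =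
      U.1 * (Matrix.diagonal (fun i => (lam i : ℂ)) * ((Matrix.of fun i l => y (i, l)) *
        (Matrix.of fun i l => y (i, l)).conjTranspose)) * star U.1 := by
    rw [reducedMatrix_unitaryCoordinates, hs]
    simp only [Matrix.mul_assoc]
    rw [← Matrix.mul_assoc (star _) U.1, Unitary.coe_star_mul_self, Matrix.one_mul]
    rfl
  rw [h, Matrix.trace_mul_cycle, Unitary.coe_star_mul_self, Matrix.one_mul, Fintype.sum_prod_type]
  simp only [Matrix.trace, Matrix.diag_apply, Matrix.diagonal_mul]
  simp only [Matrix.mul_apply, Matrix.conjTranspose_apply, Matrix.of_apply, Complex.star_def,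
    Complex.mul_conj', Finset.mul_sum, Complex.re_sum]
  refine Finset.sum_congr rfl fun i _ => Finset.sum_congr rfl fun l _ => ?_
  norm_cast

end Gaussian

/-! ### The tail bound for a single observable -/

/-- The Chernoff estimate for eigenvalues `x` with `∑ x ≥ α` and `∑ x² ≤ 1`. With `r = √(1 + α)`,
the parameter `t = 1 - 1 / r` turns the exponent `t α - r t²` into exactly `(r - 1)²`. -/
theorem prod_inv_one_add_mul_le {ι : Type*} [Fintype ι] (x : ι → ℝ) {α : ℝ} (hα : 0 < α)
    (h1 : α ≤ ∑ i, x i) (h2 : ∑ i, x i ^ 2 ≤ 1) :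
    (∀ i, 0 < 1 + (1 - (√(1 + α))⁻¹) * x i) ∧
      ∏ i, (1 + (1 - (√(1 + α))⁻¹) * x i)⁻¹ ≤ Real.exp (-(√(1 + α) - 1) ^ 2) := by
  have hr2 : √(1 + α) ^ 2 = 1 + α := Real.sq_sqrt (by linarith)
  have hr : 1 < √(1 + α) := by
    rw [Real.lt_sqrt (by norm_num)]; linarith
  set r := √(1 + α)
  set t := 1 - r⁻¹ with ht
  have hr0 : 0 < r := by linarith
  have ht0 : 0 ≤ t := by
    rw [ht, sub_nonneg]; exact inv_le_one_of_one_le₀ hr.le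
  have hx : ∀ i, -1 ≤ x i := by
    intro i
    have : x i ^ 2 ≤ 1 :=
      (Finset.single_le_sum (f := fun i => x i ^ 2) (fun j _ => sq_nonneg (x j))
        (Finset.mem_univ i)).trans h2
    exact (abs_le.1 ((sq_le_one_iff_abs_le_one _).1 this)).1
  have hlow : ∀ i, r⁻¹ ≤ 1 + t * x i := by
    intro i
    have := mul_le_mul_of_nonneg_left (hx i) ht0
    rw [ht] at this ⊢
    linarith
  have hpos : ∀ i, 0 < 1 + t * x i := fun i => (inv_pos.2 hr0).trans_le (hlow i)
  refine ⟨hpos, ?_⟩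
  -- `log (1 + y) ≥ y / (1 + y) ≥ y - r y²` as soon as `1 + y ≥ 1 / r`.
  have hi : ∀ i, (1 + t * x i)⁻¹ ≤ Real.exp (-(t * x i - r * (t * x i) ^ 2)) := by
    intro i
    rw [← Real.exp_log (inv_pos.2 (hpos i)), Real.exp_le_exp, Real.log_inv, neg_le_neg_iff]
    refine le_trans ?_ (Real.one_sub_inv_le_log_of_pos (hpos i))
    have h3 : (1 + t * x i)⁻¹ ≤ r := inv_le_of_inv_le₀ hr0 (hlow i)
    have h4 : 1 - (1 + t * x i)⁻¹ = t * x i - (t * x i) ^ 2 * (1 + t * x i)⁻¹ := by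
      field_simp [(hpos i).ne']; ring
    rw [h4]
    nlinarith [mul_le_mul_of_nonneg_left h3 (sq_nonneg (t * x i))]
  calc ∏ i, (1 + t * x i)⁻¹ ≤ ∏ i, Real.exp (-(t * x i - r * (t * x i) ^ 2)) :=
        Finset.prod_le_prod (fun i _ => (inv_pos.2 (hpos i)).le) fun i _ => hi i
    _ = Real.exp (-(t * ∑ i, x i - r * t ^ 2 * ∑ i, x i ^ 2)) := by
        rw [← Real.exp_sum]
        congr 1
        rw [Finset.mul_sum, Finset.mul_sum, ← Finset.sum_sub_distrib, ← Finset.sum_neg_distrib]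
        exact Finset.sum_congr rfl fun i _ => by ring
    _ ≤ Real.exp (-(r - 1) ^ 2) := by
        rw [Real.exp_le_exp, neg_le_neg_iff]
        have h5 : (r - 1) ^ 2 = t * α - r * t ^ 2 * 1 := by
          rw [ht, show α = r ^ 2 - 1 by linarith]
          field_simp; ring
        have h6 := mul_le_mul_of_nonneg_left h1 ht0
        have h7 := mul_le_mul_of_nonneg_left h2 (by positivity : 0 ≤ r * t ^ 2)
        linarith

open MeasureTheory

theorem lintegral_exp_neg_sum_mul_norm_sq {ι : Type*} [Fintype ι] {b : ι → ℝ}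
    (hb : ∀ i, 0 < b i) :
    ∫⁻ y : ι → ℂ, ENNReal.ofReal (Real.exp (-∑ i, b i * ‖y i‖ ^ 2)) =
      ENNReal.ofReal (∏ i, Real.pi / b i) := by
  have h1 : ∀ i, ∫ z : ℂ, Real.exp (-b i * ‖z‖ ^ 2) = Real.pi / b i := by
    intro i
    rw [GaussianFourier.integral_rexp_neg_mul_sq_norm (hb i)]
    simp
  have h2 : ∀ i, Integrable fun z : ℂ => Real.exp (-b i * ‖z‖ ^ 2) := by
    intro i
    apply Integrable.of_integral_ne_zero
    rw [h1]
    exact (div_pos Real.pi_pos (hb i)).ne'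
  have h3 : (fun y : ι → ℂ => Real.exp (-∑ i, b i * ‖y i‖ ^ 2)) =
      fun y => ∏ i, Real.exp (-b i * ‖y i‖ ^ 2) := by
    funext y
    rw [← Real.exp_sum]
    simp
  have h4 := integral_fintype_prod_volume_eq_prod (ι := ι) (E := fun _ => ℂ)
    fun i z => Real.exp (-b i * ‖z‖ ^ 2)
  simp only [h1] at h4
  have h5 : Integrable fun y : ι → ℂ => ∏ i, Real.exp (-b i * ‖y i‖ ^ 2) :=
    Integrable.fintype_prod h2
  rw [← h4, ofReal_integral_eq_lintegral_ofReal h5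
    (ae_of_all _ fun y => Finset.prod_nonneg fun i _ => (Real.exp_pos _).le)]
  refine lintegral_congr fun y => ?_
  rw [congrFun h3 y]

variable {ι κ : Type*} [Fintype ι] [Fintype κ] [DecidableEq ι]

/-- Gaussian integrals over the bipartite space, computed in an eigenbasis of `H`. The constant
`c` compares the two normalizations of Lebesgue measure. -/
theorem exists_lintegral_exp_neg_add_re_trace {H : Matrix ι ι ℂ} (hH : H.IsHermitian) :
    ∃ c : ENNReal, c ≠ 0 ∧ c ≠ ⊤ ∧ ∀ t : ℝ, (∀ i, 0 < 1 + t * hH.eigenvalues i) →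
      ∫⁻ x : EuclideanSpace ℂ (ι × κ),
        ENNReal.ofReal (Real.exp (-(‖x‖ ^ 2 + t * (H * reducedMatrix x).trace.re))) =
      c * ENNReal.ofReal (∏ p : ι × κ, Real.pi / (1 + t * hH.eigenvalues p.1)) := by
  let L := unitaryCoordinates hH.eigenvectorUnitary κ
  have hL : (Measure.map L volume).IsAddHaarMeasure := L.isAddHaarMeasure_map volume
  have hc := Measure.isAddLeftInvariant_eq_smul
    (volume : Measure (EuclideanSpace ℂ (ι × κ))) (Measure.map L volume)
  have hc0 : Measure.addHaarScalarFactor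
      (volume : Measure (EuclideanSpace ℂ (ι × κ))) (Measure.map L volume) ≠ 0 :=
    (Measure.addHaarScalarFactor_pos_of_isAddHaarMeasure _ _).ne'
  refine ⟨_, ENNReal.coe_ne_zero.2 hc0, ENNReal.coe_ne_top, fun t ht => ?_⟩
  conv_lhs => rw [hc]
  have hmeas : Measurable fun x : EuclideanSpace ℂ (ι × κ) =>
      ENNReal.ofReal (Real.exp (-(‖x‖ ^ 2 + t * (H * reducedMatrix x).trace.re))) := by
    have := continuous_reducedMatrix (ι := ι) (κ := κ)
    refine Measurable.ennreal_ofReal (Continuous.measurable ?_)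
    have h2 : Continuous fun x : EuclideanSpace ℂ (ι × κ) => (H * reducedMatrix x).trace := by
      fun_prop
    fun_prop
  rw [lintegral_smul_measure, lintegral_map hmeas L.continuous.measurable,
    ← lintegral_exp_neg_sum_mul_norm_sq (b := fun p : ι × κ => 1 + t * hH.eigenvalues p.1)
      fun p => ht p.1]
  congr 1
  refine lintegral_congr fun y => ?_
  rw [norm_sq_unitaryCoordinates, re_trace_mul_reducedMatrix_unitaryCoordinates, Finset.mul_sum,
    ← Finset.sum_add_distrib]
  congr 3
  exact Finset.sum_congr rfl fun p _ => by ring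

/-- The tail bound for a single observable `H`: the probability that its expectation value is
nonpositive decays exponentially in the dimension of the environment, with a rate that depends only
on the ratio `tr H / √(tr H²)`. -/
theorem uniformPureState_re_trace_nonpos_le [Nonempty ι] [Nonempty κ] {H : Matrix ι ι ℂ}
    (hH : H.IsHermitian) {α s : ℝ} (hα : 0 < α) (hs : 0 < s) (h1 : α * s ≤ H.trace.re)
    (h2 : (H * H).trace.re ≤ s ^ 2) :
    uniformPureState (ι × κ) {φ | (H * partialTraceSnd (pureProjector φ)).trace.re ≤ 0} ≤
      ENNReal.ofReal (Real.exp (-(√(1 + α) - 1) ^ 2 * Fintype.card κ)) := by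
  rw [hH.re_trace] at h1
  rw [hH.re_trace_mul_self] at h2
  obtain ⟨hpos, hprod⟩ := prod_inv_one_add_mul_le (fun i => hH.eigenvalues i / s) hα
    (by rw [← Finset.sum_div, le_div_iff₀ hs]; exact h1)
    (by simp only [div_pow]; rw [← Finset.sum_div, div_le_one (by positivity)]; exact h2)
  set δ := √(1 + α) - 1
  set t := (1 - (√(1 + α))⁻¹) / s with ht
  have ht0 : 0 ≤ t := by
    refine div_nonneg (sub_nonneg.2 (inv_le_one_of_one_le₀ ?_)) hs.le
    exact Real.one_le_sqrt.2 (by linarith)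
  have hconv : ∀ i, 1 + (1 - (√(1 + α))⁻¹) * (hH.eigenvalues i / s) =
      1 + t * hH.eigenvalues i := fun i => by rw [ht]; ring
  simp only [hconv] at hpos hprod
  obtain ⟨c, hc0, hct, hc⟩ := exists_lintegral_exp_neg_add_re_trace (κ := κ) hH
  have hg := hc 0 (by simp)
  simp only [zero_mul, add_zero, div_one, Finset.prod_const] at hg
  have hF := hc t hpos
  have hcont : Continuous fun x : EuclideanSpace ℂ (ι × κ) => (H * reducedMatrix x).trace.re := by
    have := continuous_reducedMatrix (ι := ι) (κ := κ)
    have h2 : Continuous fun x : EuclideanSpace ℂ (ι × κ) => (H * reducedMatrix x).trace := by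
      fun_prop
    fun_prop
  have hS : MeasurableSet {φ : unitVectors (ι × κ) |
      (H * partialTraceSnd (pureProjector φ)).trace.re ≤ 0} := by
    refine (isClosed_le ?_ continuous_const).measurableSet
    exact hcont.comp continuous_subtype_val
  have key := toSphere_mul_lintegral_le (volume : Measure (EuclideanSpace ℂ (ι × κ))) hS
    (g := fun r => ENNReal.ofReal (Real.exp (-r ^ 2)))
    (F := fun x => ENNReal.ofReal (Real.exp (-(‖x‖ ^ 2 + t * (H * reducedMatrix x).trace.re))))
    (by fun_prop) (by fun_prop) (by
      intro u hu r hr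
      apply ENNReal.ofReal_le_ofReal
      rw [Real.exp_le_exp, neg_le_neg_iff, norm_smul, norm_eq_of_mem_sphere, mul_one,
        Real.norm_of_nonneg hr.le, reducedMatrix_smul, Matrix.mul_smul, Matrix.trace_smul,
        Complex.smul_re]
      have : (H * reducedMatrix u.1).trace.re ≤ 0 := hu
      have h3 : t * (r ^ 2 • (H * reducedMatrix u.1).trace.re) ≤ 0 :=
        mul_nonpos_of_nonneg_of_nonpos ht0 (mul_nonpos_of_nonneg_of_nonpos (sq_nonneg r) this)
      linarith)
  rw [hg, hF] at key
  have hU0 : (volume : Measure (EuclideanSpace ℂ (ι × κ))).toSphere Set.univ ≠ 0 := by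
    rw [Ne, Measure.measure_univ_eq_zero]; exact Measure.toSphere_ne_zero _
  have hUt : (volume : Measure (EuclideanSpace ℂ (ι × κ))).toSphere Set.univ ≠ ⊤ :=
    measure_ne_top _ _
  have hbound : ENNReal.ofReal (∏ p : ι × κ, Real.pi / (1 + t * hH.eigenvalues p.1)) ≤
      ENNReal.ofReal (Real.exp (-δ ^ 2 * Fintype.card κ)) *
        ENNReal.ofReal (Real.pi ^ (Finset.univ : Finset (ι × κ)).card) := by
    rw [← ENNReal.ofReal_mul (Real.exp_pos _).le]
    apply ENNReal.ofReal_le_ofReal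
    simp only [div_eq_mul_inv]
    rw [Finset.prod_mul_distrib, Finset.prod_const, mul_comm]
    refine mul_le_mul_of_nonneg_right ?_ (by positivity)
    rw [Fintype.prod_prod_type]
    simp only [Finset.prod_const, Finset.card_univ]
    rw [Finset.prod_pow, mul_comm, Real.exp_nat_mul]
    exact pow_le_pow_left₀ (Finset.prod_nonneg fun i _ => (inv_pos.2 (hpos i)).le) hprod _
  rw [uniformPureState, Measure.smul_apply, smul_eq_mul, ENNReal.inv_mul_le_iff hU0 hUt]
  have hA0 : c * ENNReal.ofReal (Real.pi ^ (Finset.univ : Finset (ι × κ)).card) ≠ 0 :=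
    mul_ne_zero hc0 (ENNReal.ofReal_pos.2 (by positivity)).ne'
  have hAt : c * ENNReal.ofReal (Real.pi ^ (Finset.univ : Finset (ι × κ)).card) ≠ ⊤ :=
    ENNReal.mul_ne_top hct ENNReal.ofReal_ne_top
  rw [← ENNReal.mul_le_mul_iff_left hA0 hAt]
  refine key.trans ?_
  refine (mul_le_mul_right (mul_le_mul_right hbound c) _).trans_eq ?_
  ring

/-! ### Density matrices, the union bound and witnesses -/

section Density

variable {ι κ : Type*} [Fintype ι] [Fintype κ]

instance borelSpace_matrix : BorelSpace (Matrix ι κ ℂ) :=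
  inferInstanceAs (BorelSpace (ι → κ → ℂ))

theorem Matrix.IsHermitian.re_trace_mul_self_eq_sum {A : Matrix ι ι ℂ} (hA : A.IsHermitian) :
    (A * A).trace.re = ∑ i, ∑ j, ‖A i j‖ ^ 2 := by
  simp only [Matrix.trace, Matrix.mul_apply, Matrix.diag_apply, Complex.re_sum]
  refine Finset.sum_congr rfl fun i _ => Finset.sum_congr rfl fun j _ => ?_
  rw [← hA.apply j i, Complex.star_def, Complex.mul_conj']
  norm_cast

theorem isClosed_densityMatrices : IsClosed (densityMatrices ι) := by
  have h : densityMatrices ι = {ρ | ρ.conjTranspose = ρ} ∩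
      (⋂ x : ι → ℂ, {ρ | 0 ≤ star x ⬝ᵥ ρ.mulVec x}) ∩ {ρ | ρ.trace = 1} := by
    ext ρ
    simp [densityMatrices, Matrix.posSemidef_iff_dotProduct_mulVec, Matrix.IsHermitian]
  rw [h]
  refine ((isClosed_eq (by fun_prop) continuous_id).inter
    (isClosed_iInter fun x => isClosed_le continuous_const ?_)).inter
    (isClosed_eq (by fun_prop) continuous_const)
  fun_prop

theorem norm_apply_le_one_of_mem_densityMatrices {ρ : Matrix ι ι ℂ} (hρ : ρ ∈ densityMatrices ι)
    (i j : ι) : ‖ρ i j‖ ≤ 1 := by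
  have h1 := hρ.1.re_trace_mul_self_le
  rw [hρ.1.isHermitian.re_trace_mul_self_eq_sum, hρ.2] at h1
  have h2 : ‖ρ i j‖ ^ 2 ≤ ∑ i, ∑ j, ‖ρ i j‖ ^ 2 :=
    (Finset.single_le_sum (f := fun j => ‖ρ i j‖ ^ 2) (fun _ _ => by positivity)
      (Finset.mem_univ j)).trans (Finset.single_le_sum (f := fun i => ∑ j, ‖ρ i j‖ ^ 2)
      (fun _ _ => by positivity) (Finset.mem_univ i))
  have h3 : ‖ρ i j‖ ^ 2 ≤ 1 := by simpa using h2.trans h1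
  exact (sq_le_one_iff₀ (norm_nonneg _)).1 h3

theorem isCompact_densityMatrices : IsCompact (densityMatrices ι) := by
  have hc : IsCompact (Set.univ.pi fun _ : ι =>
      Set.univ.pi fun _ : ι => Metric.closedBall (0 : ℂ) 1) :=
    isCompact_univ_pi fun _ => isCompact_univ_pi fun _ => isCompact_closedBall _ _
  refine IsCompact.of_isClosed_subset (X := Matrix ι ι ℂ) hc isClosed_densityMatrices
    fun ρ hρ => ?_
  exact fun i _ j _ => by simpa using norm_apply_le_one_of_mem_densityMatrices hρ i j

theorem convex_densityMatrices : Convex ℝ (densityMatrices ι) := by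
  rintro ρ hρ σ hσ a b ha hb hab
  refine ⟨(hρ.1.smul ha).add (hσ.1.smul hb), ?_⟩
  rw [Matrix.trace_add, Matrix.trace_smul, Matrix.trace_smul, hρ.2, hσ.2, ← add_smul, hab, one_smul]

theorem separableStates_subset_densityMatrices (α β : Type*) [Fintype α] [Fintype β] :
    separableStates α β ⊆ densityMatrices (α × β) := by
  refine convexHull_min ?_ convex_densityMatrices
  rintro _ ⟨ρ, hρ, σ, hσ, rfl⟩
  exact ⟨hρ.1.kronecker hσ.1, by rw [Matrix.trace_kronecker, hρ.2, hσ.2, one_mul]⟩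

/-- The union bound over finitely many observables. The event itself need not be measurable, since
it is only compared with measurable events on the closed set of density matrices. -/
theorem inducedDistribution_real_le [Nonempty ι] [Nonempty κ] {G : Type*} [Fintype G]
    (H : G → Matrix ι ι ℂ) (hH : ∀ g, (H g).IsHermitian) {α : ℝ} (hα : 0 < α)
    (hs : ∀ g, ∃ s : ℝ, 0 < s ∧ α * s ≤ (H g).trace.re ∧ (H g * H g).trace.re ≤ s ^ 2)
    {S : Set (Matrix ι ι ℂ)}
    (hS : ∀ ρ ∈ densityMatrices ι, ρ ∈ S → ∃ g, (H g * ρ).trace.re ≤ 0) :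
    (inducedDistribution ι κ).real S ≤
      Fintype.card G * Real.exp (-(√(1 + α) - 1) ^ 2 * Fintype.card κ) := by
  classical
  have hf : Measurable fun φ : unitVectors (ι × κ) => partialTraceSnd (pureProjector φ) :=
    (continuous_reducedMatrix.comp continuous_subtype_val).measurable
  have hm : ∀ g, MeasurableSet {ρ : Matrix ι ι ℂ | (H g * ρ).trace.re ≤ 0} := fun g => by
    refine (isClosed_le ?_ continuous_const).measurableSet
    have : Continuous fun ρ : Matrix ι ι ℂ => (H g * ρ).trace := by fun_prop
    fun_prop
  have hsub : S ⊆ (densityMatrices ι)ᶜ ∪ ⋃ g, {ρ | (H g * ρ).trace.re ≤ 0} := by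
    intro ρ hρ
    by_cases h : ρ ∈ densityMatrices ι
    · exact Or.inr (Set.mem_iUnion.2 (hS ρ h hρ))
    · exact Or.inl h
  have h0 : inducedDistribution ι κ (densityMatrices ι)ᶜ = 0 := by
    rw [inducedDistribution, Measure.map_apply hf isClosed_densityMatrices.measurableSet.compl]
    convert measure_empty (μ := uniformPureState (ι × κ))
    ext φ
    simpa using partialTraceSnd_pureProjector_mem φ
  have hg : ∀ g, inducedDistribution ι κ {ρ | (H g * ρ).trace.re ≤ 0} ≤
      ENNReal.ofReal (Real.exp (-(√(1 + α) - 1) ^ 2 * Fintype.card κ)) := fun g => by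
    obtain ⟨s, hs0, h1, h2⟩ := hs g
    rw [inducedDistribution, Measure.map_apply hf (hm g)]
    exact uniformPureState_re_trace_nonpos_le (hH g) hα hs0 h1 h2
  have htot : inducedDistribution ι κ S ≤ Fintype.card G *
      ENNReal.ofReal (Real.exp (-(√(1 + α) - 1) ^ 2 * Fintype.card κ)) :=
    calc inducedDistribution ι κ S
        ≤ inducedDistribution ι κ (densityMatrices ι)ᶜ +
          inducedDistribution ι κ (⋃ g, {ρ | (H g * ρ).trace.re ≤ 0}) :=
          (measure_mono hsub).trans (measure_union_le _ _)
      _ ≤ 0 + ∑ g, inducedDistribution ι κ {ρ | (H g * ρ).trace.re ≤ 0} := by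
          rw [h0]; gcongr; exact measure_iUnion_fintype_le _ _
      _ ≤ _ := by
          rw [zero_add]
          exact (Finset.sum_le_sum fun g _ => hg g).trans_eq (by simp)
  refine ENNReal.toReal_le_of_le_ofReal (by positivity) (htot.trans_eq ?_)
  rw [ENNReal.ofReal_mul (by positivity), ENNReal.ofReal_natCast]

end Density

section Witness

variable {α β : Type*} [Fintype α] [Fintype β]

theorem Matrix.BlockPositive.re_trace_nonneg {W : Matrix (α × β) (α × β) ℂ}
    (hW : W.BlockPositive) : 0 ≤ W.trace.re := by
  classical
  rw [Matrix.trace, Complex.re_sum]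
  refine Finset.sum_nonneg fun p _ => ?_
  have h := hW.2 (Pi.single p.1 1) (Pi.single p.2 1)
  have hp : (fun q : α × β => (Pi.single p.1 1 : α → ℂ) q.1 * (Pi.single p.2 1 : β → ℂ) q.2) =
      Pi.single p 1 := by
    ext q
    simp only [Pi.single_apply, Prod.ext_iff]
    split_ifs <;> simp_all
  rw [hp] at h
  simpa using h

theorem exists_smul_vecMulVec_mem_densityMatrices {γ : Type*} [Fintype γ] {v : γ → ℂ}
    (hv : v ≠ 0) :
    ∃ r : ℝ, 0 < r ∧ r⁻¹ • Matrix.vecMulVec v (star v) ∈ densityMatrices γ := by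
  have htr : (Matrix.vecMulVec v (star v)).trace = ((∑ i, ‖v i‖ ^ 2 : ℝ) : ℂ) := by
    simp [Matrix.trace, Matrix.vecMulVec_apply, Complex.mul_conj']
  obtain ⟨i, hi⟩ := Function.ne_iff.1 hv
  have hpos : 0 < ∑ i, ‖v i‖ ^ 2 :=
    Finset.sum_pos' (fun _ _ => by positivity) ⟨i, Finset.mem_univ i, by
      have := norm_pos_iff.2 hi; positivity⟩
  refine ⟨_, hpos, (Matrix.posSemidef_vecMulVec_self_star v).smul (inv_pos.2 hpos).le, ?_⟩
  rw [Matrix.trace_smul, htr, Complex.real_smul, ← Complex.ofReal_mul,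
    inv_mul_cancel₀ hpos.ne', Complex.ofReal_one]

/-- A Hermitian matrix with nonnegative expectation values in all product states is
block-positive. -/
theorem Matrix.blockPositive_of_forall_density {W : Matrix (α × β) (α × β) ℂ}
    (hW : W.IsHermitian)
    (h : ∀ ρ ∈ densityMatrices α, ∀ σ ∈ densityMatrices β, 0 ≤ (W * (ρ ⊗ₖ σ)).trace.re) :
    W.BlockPositive := by
  refine ⟨hW, fun a b => ?_⟩
  by_cases ha : a = 0
  · simp [ha, dotProduct]
  by_cases hb : b = 0
  · simp [hb, dotProduct]
  obtain ⟨r, hr, har⟩ := exists_smul_vecMulVec_mem_densityMatrices ha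
  obtain ⟨s, hs, hbs⟩ := exists_smul_vecMulVec_mem_densityMatrices hb
  have h1 := h _ har _ hbs
  rw [smul_kronecker, kronecker_smul, Matrix.mul_smul, Matrix.mul_smul, trace_smul, trace_smul,
    Complex.smul_re, Complex.smul_re] at h1
  have h2 : (W * (vecMulVec a (star a) ⊗ₖ vecMulVec b (star b))).trace =
      star (fun p : α × β => a p.1 * b p.2) ⬝ᵥ W.mulVec fun p : α × β => a p.1 * b p.2 := by
    simp only [Matrix.trace, Matrix.mul_apply, diag_apply, dotProduct, mulVec, Pi.star_apply,
      kroneckerMap_apply, vecMulVec_apply, star_mul', Finset.mul_sum]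
    refine Finset.sum_congr rfl fun p _ => Finset.sum_congr rfl fun q _ => by ring
  rw [h2] at h1
  have h3 : 0 ≤ r * (s * (r⁻¹ • s⁻¹ • (star (fun p : α × β => a p.1 * b p.2) ⬝ᵥ
      W.mulVec fun p : α × β => a p.1 * b p.2).re)) := by positivity
  simp only [smul_eq_mul] at h3
  convert h3 using 1
  field_simp

/-- If no separable state is consistent with the expectation values of `O` in `ρ`, then some
entanglement witness in the real span of `O` and the identity detects `ρ`. -/
theorem exists_blockPositive_of_feasibleRegion_inter_eq_empty [DecidableEq (α × β)] {m : ℕ}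
    {O : Fin m → Matrix (α × β) (α × β) ℂ} (hO : ∀ i, (O i).IsHermitian)
    {ρ : Matrix (α × β) (α × β) ℂ} (hρ : ρ ∈ densityMatrices (α × β))
    (h : feasibleRegion O ρ ∩ separableStates α β = ∅) :
    ∃ (c : Fin m → ℝ) (u : ℝ), (∑ i, c i • O i - u • 1).BlockPositive ∧
      ((∑ i, c i • O i - u • 1) * ρ).trace.re < 0 := by
  let T : Matrix (α × β) (α × β) ℂ →ₗ[ℝ] (Fin m → ℝ) :=
  { toFun := fun σ i => (O i * σ).trace.re
    map_add' := fun σ τ => by ext i; simp [Matrix.mul_add]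
    map_smul' := fun r σ => by ext i; simp }
  have hTc : Continuous T := by
    refine continuous_pi fun i => ?_
    have : Continuous fun σ : Matrix (α × β) (α × β) ℂ => (O i * σ).trace := by fun_prop
    exact Complex.continuous_re.comp this
  set P : Set (Matrix (α × β) (α × β) ℂ) :=
    {τ | ∃ ρ ∈ densityMatrices α, ∃ σ ∈ densityMatrices β, τ = ρ ⊗ₖ σ} with hP
  have hPc : IsCompact P := by
    have hk : Continuous fun p : Matrix α α ℂ × Matrix β β ℂ => p.1 ⊗ₖ p.2 := by
      refine continuous_matrix fun i j => ?_
      simp only [Matrix.kroneckerMap_apply]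
      fun_prop
    convert (isCompact_densityMatrices.prod isCompact_densityMatrices).image hk
    ext τ
    constructor
    · rintro ⟨ρ, hρ, σ, hσ, rfl⟩
      exact ⟨(ρ, σ), ⟨hρ, hσ⟩, rfl⟩
    · rintro ⟨⟨ρ, σ⟩, ⟨hρ, hσ⟩, rfl⟩
      exact ⟨ρ, hρ, σ, hσ, rfl⟩
  have himage : T '' separableStates α β = convexHull ℝ (T '' P) := T.image_convexHull P
  have hclosed : IsClosed (T '' separableStates α β) := by
    rw [himage]
    exact (isCompact_convexHull_of_isCompact (hPc.image hTc)).isClosed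
  have hconv : Convex ℝ (T '' separableStates α β) := by
    rw [himage]; exact convex_convexHull ℝ _
  have him : ∀ i, ∀ σ ∈ densityMatrices (α × β), (O i * σ).trace.im = 0 := by
    intro i σ hσ
    rw [← Complex.conj_eq_iff_im, ← Complex.star_def, ← Matrix.trace_conjTranspose,
      Matrix.conjTranspose_mul, (hO i).eq, hσ.1.isHermitian.eq, Matrix.trace_mul_comm]
  have hnot : T ρ ∉ T '' separableStates α β := by
    rintro ⟨σ, hσ, hT⟩
    have hσd := separableStates_subset_densityMatrices α β hσ
    refine (Set.eq_empty_iff_forall_notMem.1 h σ) ⟨⟨hσd, fun i => ?_⟩, hσ⟩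
    exact Complex.ext (congrFun hT i) (by rw [him i σ hσd, him i ρ hρ])
  obtain ⟨f, u, hfρ, hf⟩ := geometric_hahn_banach_point_closed hconv hclosed hnot
  have hW : ∀ σ ∈ densityMatrices (α × β),
      ((∑ i, f (Pi.single i 1) • O i - u • (1 : Matrix (α × β) (α × β) ℂ)) * σ).trace.re =
        f (T σ) - u := by
    intro σ hσ
    have hfT : f (T σ) = ∑ i, f (Pi.single i 1) * (O i * σ).trace.re := by
      conv_lhs => rw [pi_eq_sum_univ' (T σ)]
      simp only [map_sum, map_smul, smul_eq_mul]
      refine Finset.sum_congr rfl fun i _ => ?_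
      rw [mul_comm]; congr 2
    rw [hfT, Matrix.sub_mul, Matrix.trace_sub, Matrix.sum_mul, Matrix.trace_sum, Complex.sub_re,
      Complex.re_sum]
    simp [hσ.2]
  refine ⟨fun i => f (Pi.single i 1), u, ?_, ?_⟩
  · refine Matrix.blockPositive_of_forall_density ?_ fun σ hσ τ hτ => ?_
    · refine Matrix.IsHermitian.sub ?_ ?_
      · exact isSelfAdjoint_sum _ fun i _ => (IsSelfAdjoint.all (f (Pi.single i 1))).smul (hO i)
      · exact (IsSelfAdjoint.all u).smul Matrix.isHermitian_one
    · have hmem : σ ⊗ₖ τ ∈ separableStates α β := subset_convexHull ℝ _ ⟨σ, hσ, τ, hτ, rfl⟩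
      rw [hW _ (separableStates_subset_densityMatrices α β hmem)]
      linarith [hf _ ⟨_, hmem, rfl⟩]
  · rw [hW _ hρ]; linarith

end Witness

/-! ### Hilbert–Schmidt geometry and normalized witnesses -/

section HilbertSchmidt

variable {ι : Type*} [Fintype ι]

/-- Matrices as vectors of their entries; the Euclidean inner product becomes the real
Hilbert–Schmidt inner product. -/
def hilbertSchmidtEquiv (ι : Type*) : Matrix ι ι ℂ ≃ₗ[ℝ] EuclideanSpace ℂ (ι × ι) where
  toFun A := WithLp.toLp 2 fun p => A p.1 p.2
  invFun x := Matrix.of fun i j => x (i, j)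
  map_add' A B := by ext p; simp
  map_smul' r A := by ext p; simp
  left_inv A := rfl
  right_inv x := rfl

theorem inner_hilbertSchmidtEquiv (A B : Matrix ι ι ℂ) :
    inner ℝ (hilbertSchmidtEquiv ι A) (hilbertSchmidtEquiv ι B) =
      (A.conjTranspose * B).trace.re := by
  rw [PiLp.inner_apply, Fintype.sum_prod_type]
  simp only [Matrix.trace, Matrix.mul_apply, Matrix.diag_apply, Complex.re_sum]
  rw [Finset.sum_comm]
  refine Finset.sum_congr rfl fun i _ => Finset.sum_congr rfl fun j _ => ?_
  rw [Complex.inner, Matrix.conjTranspose_apply, mul_comm]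
  rfl

/-- The traceless Hermitian matrices. -/
def tracelessHermitian (ι : Type*) [Fintype ι] : Submodule ℝ (Matrix ι ι ℂ) where
  carrier := {A | A.IsHermitian ∧ A.trace = 0}
  add_mem' := fun hA hB => ⟨hA.1.add hB.1, by rw [Matrix.trace_add, hA.2, hB.2, add_zero]⟩
  zero_mem' := ⟨Matrix.isHermitian_zero, Matrix.trace_zero _ _⟩
  smul_mem' := fun r _ hA => ⟨(IsSelfAdjoint.all r).smul hA.1,
    by rw [Matrix.trace_smul, hA.2, smul_zero]⟩

/-- A family of traceless Hermitian matrices that is orthonormal for the Hilbert–Schmidt inner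
product. -/
structure TracelessOrthonormal {n : ℕ} (X : Fin n → Matrix ι ι ℂ) : Prop where
  mem : ∀ i, X i ∈ tracelessHermitian ι
  re_trace_mul : ∀ i j, (X i * X j).trace.re = if i = j then 1 else 0

/-- The Hermitian matrix with identity component `a` and traceless coordinates `w`. -/
noncomputable def blochMatrix [DecidableEq ι] {n : ℕ} (X : Fin n → Matrix ι ι ℂ) (a : ℝ)
    (w : Fin n → ℝ) : Matrix ι ι ℂ :=
  a • 1 + ∑ i, w i • X i

theorem re_trace_blochMatrix_mul [DecidableEq ι] {n : ℕ} (X : Fin n → Matrix ι ι ℂ) (a : ℝ)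
    (w : Fin n → ℝ) {ρ : Matrix ι ι ℂ} (hρ : ρ ∈ densityMatrices ι) :
    (blochMatrix X a w * ρ).trace.re = a + ∑ i, w i * (X i * ρ).trace.re := by
  rw [blochMatrix, Matrix.add_mul, Matrix.trace_add, Complex.add_re, Matrix.sum_mul,
    Matrix.trace_sum, Complex.re_sum]
  simp [hρ.2]

namespace TracelessOrthonormal

variable {n : ℕ} {X : Fin n → Matrix ι ι ℂ}

theorem isHermitian_blochMatrix [DecidableEq ι] (hX : TracelessOrthonormal X)
    (a : ℝ) (w : Fin n → ℝ) :
    (blochMatrix X a w).IsHermitian :=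
  Matrix.IsHermitian.add ((IsSelfAdjoint.all a).smul Matrix.isHermitian_one)
    (((tracelessHermitian ι).sum_mem fun i _ =>
      (tracelessHermitian ι).smul_mem (w i) (hX.mem i)).1)

theorem re_trace_blochMatrix [DecidableEq ι] (hX : TracelessOrthonormal X)
    (a : ℝ) (w : Fin n → ℝ) :
    (blochMatrix X a w).trace.re = a * Fintype.card ι := by
  have h : (∑ i, w i • X i).trace = 0 := ((tracelessHermitian ι).sum_mem fun i _ =>
      (tracelessHermitian ι).smul_mem (w i) (hX.mem i)).2
  rw [blochMatrix, Matrix.trace_add, h, Matrix.trace_smul, Matrix.trace_one, add_zero,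
    Complex.smul_re]
  simp

theorem re_trace_sum_mul_self (hX : TracelessOrthonormal X)
    (w : Fin n → ℝ) :
    ((∑ i, w i • X i) * ∑ i, w i • X i).trace.re = ∑ i, w i ^ 2 := by
  simp only [Finset.sum_mul_sum, Matrix.trace_sum, Complex.re_sum, Matrix.smul_mul,
    Matrix.mul_smul, Matrix.trace_smul, Complex.smul_re, hX.re_trace_mul]
  simp [sq]

theorem re_trace_blochMatrix_mul_self [DecidableEq ι] (hX : TracelessOrthonormal X)
    (a : ℝ) (w : Fin n → ℝ) :
    (blochMatrix X a w * blochMatrix X a w).trace.re =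
      a ^ 2 * Fintype.card ι + ∑ i, w i ^ 2 := by
  have h : (∑ i, w i • X i).trace = 0 := ((tracelessHermitian ι).sum_mem fun i _ =>
      (tracelessHermitian ι).smul_mem (w i) (hX.mem i)).2
  rw [← hX.re_trace_sum_mul_self w]
  generalize hA : ∑ i, w i • X i = A at h
  simp only [blochMatrix, hA, Matrix.add_mul, Matrix.mul_add, Matrix.smul_mul, Matrix.mul_smul,
    Matrix.one_mul, Matrix.mul_one, Matrix.trace_add, Matrix.trace_smul, h, Complex.add_re,
    Complex.smul_re, Matrix.trace_one, smul_zero]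
  simp
  ring

/-- Bessel's inequality for the expectation values of a state, in dual form. -/
theorem abs_sum_mul_re_trace_le (hX : TracelessOrthonormal X)
    (w : Fin n → ℝ) {ρ : Matrix ι ι ℂ}
    (hρ : ρ ∈ densityMatrices ι) :
    |∑ i, w i * (X i * ρ).trace.re| ≤ √(∑ i, w i ^ 2) := by
  have hA : (∑ i, w i • X i).IsHermitian := ((tracelessHermitian ι).sum_mem fun i _ =>
      (tracelessHermitian ι).smul_mem (w i) (hX.mem i)).1
  have h1 : ∑ i, w i * (X i * ρ).trace.re = ((∑ i, w i • X i) * ρ).trace.re := by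
    rw [Matrix.sum_mul, Matrix.trace_sum, Complex.re_sum]
    simp
  have h2 : ‖hilbertSchmidtEquiv ι (∑ i, w i • X i)‖ = √(∑ i, w i ^ 2) := by
    rw [@norm_eq_sqrt_real_inner, inner_hilbertSchmidtEquiv, hA.eq, hX.re_trace_sum_mul_self]
  have h3 : ‖hilbertSchmidtEquiv ι ρ‖ ≤ 1 := by
    rw [@norm_eq_sqrt_real_inner, inner_hilbertSchmidtEquiv, hρ.1.isHermitian.eq,
      Real.sqrt_le_left zero_le_one]
    simpa [hρ.2] using hρ.1.re_trace_mul_self_le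
  have h4 := abs_real_inner_le_norm (hilbertSchmidtEquiv ι (∑ i, w i • X i))
    (hilbertSchmidtEquiv ι ρ)
  rw [inner_hilbertSchmidtEquiv, hA.eq, h2] at h4
  rw [h1]
  exact h4.trans (mul_le_of_le_one_right (Real.sqrt_nonneg _) h3)

end TracelessOrthonormal

/-- The traceless parts of `m` Hermitian matrices lie in the span of at most `m` orthonormal traceless
Hermitian matrices. -/
theorem exists_tracelessOrthonormal [Nonempty ι] [DecidableEq ι] {m : ℕ}
    {O : Fin m → Matrix ι ι ℂ} (hO : ∀ i, (O i).IsHermitian) :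
    ∃ n ≤ m, ∃ X : Fin n → Matrix ι ι ℂ, TracelessOrthonormal X ∧
      ∀ (c : Fin m → ℝ) (u : ℝ), ∃ (a : ℝ) (w : Fin n → ℝ),
        ∑ i, c i • O i - u • 1 = blochMatrix X a w := by
  let Φ := hilbertSchmidtEquiv ι
  let τ : Fin m → ℝ := fun i => (O i).trace.re / Fintype.card ι
  let O' : Fin m → Matrix ι ι ℂ := fun i => O i - τ i • 1
  have hO' : ∀ i, O' i ∈ tracelessHermitian ι := by
    intro i
    refine ⟨(hO i).sub ((IsSelfAdjoint.all (τ i)).smul Matrix.isHermitian_one), ?_⟩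
    have him : (O i).trace.im = 0 := by rw [(hO i).trace_eq_sum_eigenvalues]; simp
    rw [Matrix.trace_sub, Matrix.trace_smul, Matrix.trace_one]
    apply Complex.ext
    · simp [τ]
    · simp [him]
  let V : Submodule ℝ (EuclideanSpace ℂ (ι × ι)) := Submodule.span ℝ (Set.range fun i => Φ (O' i))
  have hV : ∀ v ∈ V, Φ.symm v ∈ tracelessHermitian ι := by
    intro v hv
    have : V ≤ (tracelessHermitian ι).comap Φ.symm.toLinearMap := by
      refine Submodule.span_le.2 ?_
      rintro _ ⟨i, rfl⟩
      simpa using hO' i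
    exact this hv
  let b := stdOrthonormalBasis ℝ V
  refine ⟨Module.finrank ℝ V, ?_, fun i => Φ.symm (b i : EuclideanSpace ℂ (ι × ι)),
    ⟨fun i => hV _ (b i).2, fun i j => ?_⟩, fun c u => ?_⟩
  · exact (finrank_range_le_card (R := ℝ) fun i => Φ (O' i)).trans_eq (Fintype.card_fin m)
  · have h1 := orthonormal_iff_ite.1 b.orthonormal i j
    rw [← h1, Submodule.coe_inner]
    have h2 := inner_hilbertSchmidtEquiv (Φ.symm (b i : EuclideanSpace ℂ (ι × ι)))
      (Φ.symm (b j : EuclideanSpace ℂ (ι × ι)))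
    rw [(hV _ (b i).2).1.eq] at h2
    rw [← h2]
    simp [Φ]
  · have hv : Φ (∑ i, c i • O' i) ∈ V := by
      rw [map_sum]
      refine V.sum_mem fun i _ => ?_
      rw [map_smul]
      exact V.smul_mem _ (Submodule.subset_span ⟨i, rfl⟩)
    refine ⟨∑ i, c i * τ i - u, fun i => inner ℝ (b i) (⟨_, hv⟩ : V), ?_⟩
    have h1 := congrArg (fun v : V => Φ.symm (v : EuclideanSpace ℂ (ι × ι)))
      (b.sum_repr' (⟨_, hv⟩ : V))
    simp only [Submodule.coe_sum, Submodule.coe_smul, map_sum Φ.symm, map_smul Φ.symm,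
      LinearEquiv.symm_apply_apply] at h1
    rw [blochMatrix, h1]
    simp only [O', smul_sub, Finset.sum_sub_distrib, sub_smul, Finset.sum_smul, smul_smul]
    abel

end HilbertSchmidt

/-- The normalized form of a witness: a family of observables detects `ρ` only if some point `w`
of the unit ball in its traceless span makes `1 + d ∑ wᵢ tr(Xᵢ ρ)` negative. -/
theorem exists_coordinates_of_feasibleRegion_inter_eq_empty {α β : Type*} [Fintype α] [Fintype β]
    [DecidableEq (α × β)] [Nonempty (α × β)] {m : ℕ} {O : Fin m → Matrix (α × β) (α × β) ℂ}
    (hO : ∀ i, (O i).IsHermitian) :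
    ∃ n ≤ m, ∃ X : Fin n → Matrix (α × β) (α × β) ℂ, TracelessOrthonormal X ∧
      ∀ ρ ∈ densityMatrices (α × β), feasibleRegion O ρ ∩ separableStates α β = ∅ →
        ∃ w : Fin n → ℝ, ∑ i, w i ^ 2 ≤ 1 - 1 / (Fintype.card (α × β) : ℝ) ∧
          1 + Fintype.card (α × β) * ∑ i, w i * (X i * ρ).trace.re < 0 := by
  obtain ⟨n, hn, X, hX, hspan⟩ := exists_tracelessOrthonormal hO
  refine ⟨n, hn, X, hX, fun ρ hρ hempty => ?_⟩
  obtain ⟨c, u, hW, hneg⟩ := exists_blockPositive_of_feasibleRegion_inter_eq_empty hO hρ hempty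
  obtain ⟨a, w, haw⟩ := hspan c u
  rw [haw] at hW hneg
  have hd : (0 : ℝ) < Fintype.card (α × β) := by exact_mod_cast Fintype.card_pos
  set d : ℝ := (Fintype.card (α × β) : ℝ)
  have h1 := hW.re_trace_mul_self_le
  have h2 := hW.re_trace_nonneg
  rw [hX.re_trace_blochMatrix_mul_self, hX.re_trace_blochMatrix] at h1
  rw [hX.re_trace_blochMatrix] at h2
  rw [re_trace_blochMatrix_mul X a w hρ] at hneg
  have ha0 : 0 ≤ a := nonneg_of_mul_nonneg_left h2 hd
  have ha : 0 < a := by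
    refine lt_of_le_of_ne ha0 fun h => ?_
    subst h
    have hw : ∑ i, w i ^ 2 = 0 :=
      le_antisymm (by simpa using h1) (Finset.sum_nonneg fun i _ => sq_nonneg _)
    have hw' : ∀ i, w i = 0 := fun i => by
      simpa using (Finset.sum_eq_zero_iff_of_nonneg fun i _ => sq_nonneg (w i)).1 hw i
        (Finset.mem_univ i)
    simp [hw'] at hneg
  refine ⟨fun i => w i / (d * a), ?_, ?_⟩
  · simp only [div_pow]
    rw [← Finset.sum_div, div_le_iff₀ (by positivity)]
    have : (1 - 1 / d) * (d * a) ^ 2 = (a * d) ^ 2 - a ^ 2 * d := by field_simp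
    linarith
  · have h3 : 1 + d * ∑ i, w i / (d * a) * (X i * ρ).trace.re =
        (a + ∑ i, w i * (X i * ρ).trace.re) / a := by
      have h4 : ∑ i, w i / (d * a) * (X i * ρ).trace.re =
          (∑ i, w i * (X i * ρ).trace.re) / (d * a) := by
        rw [Finset.sum_div]
        exact Finset.sum_congr rfl fun i _ => by ring
      rw [h4]; field_simp
    rw [h3]
    exact div_neg_of_neg_of_pos hneg ha

/-! ### Nets of witnesses -/

section Net

/-- The midpoints of the `N` intervals of equal length that divide `[-1, 1]`. -/
noncomputable def gridPoint (N : ℕ) (j : Fin N) : ℝ := (2 * j + 1) / N - 1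

theorem exists_abs_sub_gridPoint_le {N : ℕ} (hN : 0 < N) {x : ℝ} (hx : |x| ≤ 1) :
    ∃ j : Fin N, |gridPoint N j - x| ≤ 1 / N := by
  obtain ⟨h1, h2⟩ := abs_le.1 hx
  have hN' : (0 : ℝ) < N := by exact_mod_cast hN
  set y := (x + 1) / 2 * N with hy
  have hy0 : 0 ≤ y := by have : 0 ≤ x + 1 := by linarith
                         positivity
  have hyN : y ≤ N := by
    rw [hy]; exact mul_le_of_le_one_left hN'.le (by linarith)
  have key : ∀ j : Fin N, (j : ℝ) ≤ y → y ≤ j + 1 → |gridPoint N j - x| ≤ 1 / N := by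
    intro j hj1 hj2
    have hxy : x = 2 * y / N - 1 := by rw [hy]; field_simp; ring
    have : gridPoint N j - x = (2 * (j - y) + 1) / N := by rw [gridPoint, hxy]; field_simp; ring
    rw [this, abs_div, abs_of_pos hN']
    gcongr
    rw [abs_le]; constructor <;> linarith
  rcases lt_or_ge ⌊y⌋₊ N with h | h
  · exact ⟨⟨⌊y⌋₊, h⟩, key _ (Nat.floor_le hy0) (Nat.lt_floor_add_one y).le⟩
  · -- only the right end point `y = N` is rounded down
    have hNy : (N : ℝ) ≤ y := (Nat.le_floor_iff hy0).1 h
    have hcast : ((N - 1 : ℕ) : ℝ) = N - 1 := by rw [Nat.cast_sub hN]; simp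
    refine ⟨⟨N - 1, by omega⟩, key _ ?_ ?_⟩
    · simp only [hcast]; linarith
    · simp only [hcast]; linarith

/-- The grid points that lie within `1 / N`, in each coordinate, of a point of the ball
`∑ wᵢ² ≤ R`. Discarding the others keeps the norm of all net points under control. -/
abbrev NearGrid (n N : ℕ) (R : ℝ) : Type :=
  {g : Fin n → Fin N // ∃ w : Fin n → ℝ, ∑ i, w i ^ 2 ≤ R ∧
    ∀ i, |gridPoint N (g i) - w i| ≤ 1 / N}

theorem exists_nearGrid {n N : ℕ} (hN : 0 < N) {R : ℝ} (hR : R ≤ 1) {w : Fin n → ℝ}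
    (hw : ∑ i, w i ^ 2 ≤ R) :
    ∃ g : NearGrid n N R, ∀ i, |gridPoint N (g.1 i) - w i| ≤ 1 / N := by
  have h : ∀ i, |w i| ≤ 1 := fun i => by
    rw [← sq_le_one_iff_abs_le_one]
    exact (Finset.single_le_sum (f := fun i => w i ^ 2) (fun j _ => sq_nonneg (w j))
        (Finset.mem_univ i)).trans (hw.trans hR)
  choose g hg using fun i => exists_abs_sub_gridPoint_le hN (h i)
  exact ⟨⟨g, w, hw, hg⟩, hg⟩

noncomputable instance (n N : ℕ) (R : ℝ) : Fintype (NearGrid n N R) := Fintype.ofFinite _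

theorem card_nearGrid_le (n N : ℕ) (R : ℝ) : Fintype.card (NearGrid n N R) ≤ N ^ n := by
  classical
  have := Fintype.card_le_of_injective (fun g : NearGrid n N R => g.1) Subtype.val_injective
  simpa using this

theorem sum_sq_le_of_abs_le {n : ℕ} {x : Fin n → ℝ} {r : ℝ} (hx : ∀ i, |x i| ≤ r) :
    ∑ i, x i ^ 2 ≤ n * r ^ 2 := by
  have : ∀ i ∈ Finset.univ, x i ^ 2 ≤ r ^ 2 := fun i _ => by
    rw [← sq_abs]; exact pow_le_pow_left₀ (abs_nonneg _) (hx i) 2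
  simpa using Finset.sum_le_card_nsmul _ _ _ this

theorem sum_sq_le_of_sum_sq_sub_le {n : ℕ} {v w : Fin n → ℝ} {R η : ℝ} (hR : R ≤ 1) (hη : 0 ≤ η)
    (hw : ∑ i, w i ^ 2 ≤ R) (hv : ∑ i, (v i - w i) ^ 2 ≤ η ^ 2) :
    ∑ i, v i ^ 2 ≤ R + 2 * η + η ^ 2 := by
  have h1 := Real.sum_mul_le_sqrt_mul_sqrt Finset.univ w fun i => v i - w i
  have h2 : √(∑ i, w i ^ 2) ≤ 1 := Real.sqrt_le_one.2 (hw.trans hR)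
  have h3 : √(∑ i, (v i - w i) ^ 2) ≤ η := Real.sqrt_le_iff.2 ⟨hη, hv⟩
  have h4 := mul_le_mul h2 h3 (Real.sqrt_nonneg _) zero_le_one
  have h5 : ∑ i, v i ^ 2 = ∑ i, w i ^ 2 + 2 * ∑ i, w i * (v i - w i) + ∑ i, (v i - w i) ^ 2 := by
    rw [Finset.mul_sum, ← Finset.sum_add_distrib, ← Finset.sum_add_distrib]
    exact Finset.sum_congr rfl fun i _ => by ring
  linarith

end Net

section Bounds

variable {a b k m : ℕ}

/-- The net bound with `N = O(√n d / ε)` points per coordinate, valid because all expectation values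
of a state are bounded. -/
theorem exists_detectionCapability_le_pow_mul_exp (ha : 1 ≤ a) (hb : 1 ≤ b) (hk : 1 ≤ k)
    {O : Fin m → Matrix (Fin a × Fin b) (Fin a × Fin b) ℂ} (hO : ∀ i, (O i).IsHermitian)
    {ε : ℝ} (hε : 0 < ε) (hε1 : ε < 1) :
    ∃ n ≤ m, detectionCapability k O ≤
      (2 * √(n + 1 : ℝ) * ((a : ℝ) * b) / ε) ^ n * Real.exp (-(√(2 - ε) - 1) ^ 2 * k) := by
  have : Nonempty (Fin a) := ⟨⟨0, ha⟩⟩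
  have : Nonempty (Fin b) := ⟨⟨0, hb⟩⟩
  have : Nonempty (Fin k) := ⟨⟨0, hk⟩⟩
  obtain ⟨n, hn, X, hX, hS⟩ := exists_coordinates_of_feasibleRegion_inter_eq_empty hO
  refine ⟨n, hn, ?_⟩
  have hcard : (Fintype.card (Fin a × Fin b) : ℝ) = (a : ℝ) * b := by simp
  rw [hcard] at hS
  have hd : (1 : ℝ) ≤ (a : ℝ) * b := by exact_mod_cast Nat.mul_le_mul ha hb
  set d : ℝ := (a : ℝ) * b
  -- `η` is the resolution of the net and the amount by which the identity component is lowered.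
  -- Taking it smaller than `ε` compensates for grid points outside the ball, and `2 / 3` leaves
  -- room in the number of points for rounding up.
  set η : ℝ := 2 * ε / 3 with hη
  have hη0 : 0 < η := by positivity
  set N : ℕ := ⌊√n * d / η⌋₊ + 1 with hN
  have hN0 : (0 : ℝ) < N := by positivity
  have hNη : √n * d / η < N := by rw [hN]; push_cast; exact Nat.lt_floor_add_one _
  have hNle : (N : ℝ) ≤ √n * d / η + 1 := by
    rw [hN]; push_cast; gcongr; exact Nat.floor_le (by positivity)
  have hnet : (n : ℝ) * (1 / N) ^ 2 ≤ (η / d) ^ 2 := by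
    have h1 : √n / N ≤ η / d := by
      rw [div_lt_iff₀ hη0] at hNη
      rw [div_le_div_iff₀ hN0 (by positivity)]
      linarith
    calc (n : ℝ) * (1 / N) ^ 2 = (√n / N) ^ 2 := by
          rw [div_pow √_, Real.sq_sqrt (Nat.cast_nonneg n)]; ring
      _ ≤ _ := pow_le_pow_left₀ (by positivity) h1 2
  have hR : 1 - 1 / d ≤ 1 := by
    have : 0 < 1 / d := by positivity
    linarith
  have hdist : ∀ {v w : Fin n → ℝ}, (∀ i, |v i - w i| ≤ 1 / N) →
      ∑ i, (v i - w i) ^ 2 ≤ (η / d) ^ 2 := fun h => (sum_sq_le_of_abs_le h).trans hnet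
  let H : NearGrid n N (1 - 1 / d) → Matrix (Fin a × Fin b) (Fin a × Fin b) ℂ := fun g =>
    blochMatrix X (1 - η) fun i => d * gridPoint N (g.1 i)
  have hbound := inducedDistribution_real_le (κ := Fin k) H
    (fun g => hX.isHermitian_blochMatrix _ _) (α := 1 - ε) (by linarith)
    (S := {ρ | feasibleRegion O ρ ∩ separableStates (Fin a) (Fin b) = ∅}) ?_ ?_
  · refine hbound.trans ?_
    rw [Fintype.card_fin, show 1 + (1 - ε) = 2 - ε by ring]
    refine mul_le_mul_of_nonneg_right ?_ (Real.exp_pos _).le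
    calc (Fintype.card (NearGrid n N (1 - 1 / d)) : ℝ) ≤ (N : ℝ) ^ n := by
          exact_mod_cast card_nearGrid_le _ _ _
      _ ≤ _ := by
        refine pow_le_pow_left₀ hN0.le (hNle.trans ?_) n
        -- `3 √n + 2 ≤ 4 √(n + 1)`
        have h1 : 3 * √n + 2 ≤ 4 * √(n + 1 : ℝ) := by
          rw [← abs_of_nonneg (by positivity : 0 ≤ 3 * √n + 2),
            ← abs_of_nonneg (by positivity : 0 ≤ 4 * √(n + 1 : ℝ)), ← sq_le_sq]
          have h2 := Real.sq_sqrt (Nat.cast_nonneg (α := ℝ) n)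
          have h3 := Real.sq_sqrt (by positivity : (0 : ℝ) ≤ n + 1)
          nlinarith [sq_nonneg (7 * √n - 6)]
        rw [hη, le_div_iff₀ hε]
        have h4 : (√n * d / (2 * ε / 3) + 1) * ε = 3 / 2 * √n * d + ε := by field_simp
        rw [h4]
        nlinarith [mul_le_mul_of_nonneg_right h1 (by linarith : 0 ≤ d)]
  · rintro ⟨g, w, hw, hg⟩
    have hsq := sum_sq_le_of_sum_sq_sub_le hR (by positivity : 0 ≤ η / d) hw (hdist hg)
    refine ⟨d * (1 + η ^ 2), by positivity, ?_, ?_⟩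
    · rw [hX.re_trace_blochMatrix, hcard]
      have h1 : (1 - ε) * (1 + η ^ 2) ≤ 1 - η := by
        rw [hη]
        nlinarith [mul_pos hε hε, mul_pos hε (sub_pos.2 hε1)]
      nlinarith [mul_le_mul_of_nonneg_right h1 (by linarith : 0 ≤ d)]
    · rw [hX.re_trace_blochMatrix_mul_self, hcard]
      simp only [mul_pow]
      rw [← Finset.mul_sum]
      have h1 := mul_le_mul_of_nonneg_left hsq (sq_nonneg d)
      have h2 : d ^ 2 * (1 - 1 / d + 2 * (η / d) + (η / d) ^ 2) =
          d ^ 2 - d + 2 * d * η + η ^ 2 := by field_simp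
      have h3 : (d + 1) * η ^ 2 ≤ 2 * d ^ 2 * η ^ 2 :=
        mul_le_mul_of_nonneg_right (by nlinarith) (sq_nonneg η)
      have h4 : 0 ≤ d ^ 2 * η ^ 4 := by positivity
      rw [h2] at h1
      nlinarith
  · intro ρ hρ hempty
    obtain ⟨w, hw, hneg⟩ := hS ρ hρ hempty
    obtain ⟨g, hg⟩ := exists_nearGrid (N := N) (by omega) hR hw
    refine ⟨g, ?_⟩
    rw [re_trace_blochMatrix_mul X _ _ hρ]
    have h1 := (hX.abs_sum_mul_re_trace_le (fun i => gridPoint N (g.1 i) - w i) hρ).trans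
      (Real.sqrt_le_iff.2 ⟨by positivity, hdist hg⟩)
    have h2 := mul_le_mul_of_nonneg_left ((le_abs_self _).trans h1) (by linarith : 0 ≤ d)
    rw [mul_div_cancel₀ _ (by positivity)] at h2
    simp only [sub_mul, Finset.sum_sub_distrib, mul_sub] at h2
    simp only [mul_assoc, ← Finset.mul_sum]
    linarith

/-- The net bound without a factor depending on the dimension: off an exponentially small event
all `d |tr (Xᵢ ρ)|` are less than `1`, and there `2 n + 1` grid points per coordinate are enough. -/
theorem detectionCapability_le_dimension_free (ha : 1 ≤ a) (hb : 1 ≤ b) (hk : 1 ≤ k)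
    {O : Fin m → Matrix (Fin a × Fin b) (Fin a × Fin b) ℂ} (hO : ∀ i, (O i).IsHermitian) :
    detectionCapability k O ≤
      (2 * m + 1 : ℝ) ^ (m + 1) * Real.exp (-(√(1 + 1 / 5) - 1) ^ 2 * k) := by
  have : Nonempty (Fin a) := ⟨⟨0, ha⟩⟩
  have : Nonempty (Fin b) := ⟨⟨0, hb⟩⟩
  have : Nonempty (Fin k) := ⟨⟨0, hk⟩⟩
  obtain ⟨n, hn, X, hX, hS⟩ := exists_coordinates_of_feasibleRegion_inter_eq_empty hO
  have hcard : (Fintype.card (Fin a × Fin b) : ℝ) = (a : ℝ) * b := by simp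
  rw [hcard] at hS
  have hd : (1 : ℝ) ≤ (a : ℝ) * b := by exact_mod_cast Nat.mul_le_mul ha hb
  set d : ℝ := (a : ℝ) * b
  have hd0 : 0 < d := by linarith
  have hd1 : 1 / d ≤ 1 := (div_le_one hd0).2 hd
  have hR : 1 - 1 / d ≤ 1 := by
    have : 0 < 1 / d := by positivity
    linarith
  set N : ℕ := 2 * n + 1 with hN
  have hNR : (N : ℝ) = 2 * n + 1 := by rw [hN]; push_cast; ring
  have hN0 : (0 : ℝ) < N := by positivity
  -- The left summand holds `1 / d ± Xᵢ`, with `tr H = 1` and `tr H² ≤ 2`; the right one holds the net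
  -- of witnesses, with `tr H = d / 2` and `tr H² ≤ (5 d / 2)²`. Hence the common ratio `α = 1 / 5`.
  let H : (Fin n × Bool) ⊕ NearGrid n N (1 - 1 / d) →
      Matrix (Fin a × Fin b) (Fin a × Fin b) ℂ := Sum.elim
    (fun q => blochMatrix X (1 / d) (Pi.single q.1 (if q.2 then 1 else -1)))
    (fun g => blochMatrix X (1 / 2) fun i => d * gridPoint N (g.1 i))
  have hbound := inducedDistribution_real_le (κ := Fin k) H
    (by rintro (q | g) <;> exact hX.isHermitian_blochMatrix _ _) (α := 1 / 5) (by norm_num)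
    (S := {ρ | feasibleRegion O ρ ∩ separableStates (Fin a) (Fin b) = ∅}) ?_ ?_
  · refine hbound.trans ?_
    rw [Fintype.card_fin]
    refine mul_le_mul_of_nonneg_right ?_ (Real.exp_pos _).le
    have h1 : Fintype.card ((Fin n × Bool) ⊕ NearGrid n N (1 - 1 / d)) ≤
        (2 * m + 1) ^ (m + 1) :=
      calc _ ≤ 2 * n + (2 * n + 1) ^ n := by
            have h2 : _ ≤ (2 * n + 1) ^ n := card_nearGrid_le n N (1 - 1 / d)
            simp only [Fintype.card_sum, Fintype.card_prod, Fintype.card_fin, Fintype.card_bool]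
            omega
        _ ≤ 2 * n * (2 * n + 1) ^ n + (2 * n + 1) ^ n := by
            exact Nat.add_le_add_right
              (Nat.le_mul_of_pos_right _ (Nat.pow_pos (Nat.succ_pos _))) _
        _ = (2 * n + 1) ^ (n + 1) := by ring
        _ ≤ (2 * m + 1) ^ (n + 1) := by gcongr
        _ ≤ _ := Nat.pow_le_pow_right (by omega) (by omega)
    exact_mod_cast h1
  · rintro (q | ⟨g, w, hw, hg⟩)
    · refine ⟨2, by norm_num, ?_, ?_⟩
      · simp only [H, Sum.elim_inl]
        rw [hX.re_trace_blochMatrix, hcard, one_div_mul_cancel hd0.ne']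
        norm_num
      · simp only [H, Sum.elim_inl]
        rw [hX.re_trace_blochMatrix_mul_self, hcard]
        have h1 : ∑ i, (Pi.single q.1 (if q.2 then 1 else -1) : Fin n → ℝ) i ^ 2 = 1 := by
          rw [Finset.sum_eq_single q.1]
          · rw [Pi.single_eq_same]; split_ifs <;> norm_num
          · intro i _ hi
            rw [Pi.single_eq_of_ne hi]; norm_num
          · simp
        have h2 : (1 / d) ^ 2 * d = 1 / d := by field_simp
        rw [h1, h2]
        linarith
    · have hdist : ∑ i, (gridPoint N (g i) - w i) ^ 2 ≤ 1 ^ 2 := by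
        refine (sum_sq_le_of_abs_le hg).trans ?_
        rw [div_pow, one_pow, mul_one_div, div_le_iff₀ (by positivity), hNR]
        have : (0 : ℝ) ≤ n := Nat.cast_nonneg n
        nlinarith
      have hsq := sum_sq_le_of_sum_sq_sub_le hR zero_le_one hw hdist
      refine ⟨5 / 2 * d, by positivity, ?_, ?_⟩
      · simp only [H, Sum.elim_inr]
        rw [hX.re_trace_blochMatrix, hcard]
        linarith
      · simp only [H, Sum.elim_inr]
        rw [hX.re_trace_blochMatrix_mul_self, hcard]
        simp only [mul_pow]
        rw [← Finset.mul_sum]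
        have h1 := mul_le_mul_of_nonneg_left (hsq.trans (by linarith : _ ≤ (4 : ℝ))) (sq_nonneg d)
        nlinarith
  · intro ρ hρ hempty
    obtain ⟨w, hw, hneg⟩ := hS ρ hρ hempty
    by_cases hlarge : ∃ q : Fin n × Bool, (H (Sum.inl q) * ρ).trace.re ≤ 0
    · obtain ⟨q, hq⟩ := hlarge
      exact ⟨_, hq⟩
    push Not at hlarge
    have hx : ∀ i, |d * (X i * ρ).trace.re| ≤ 1 := by
      intro i
      have h1 := hlarge (i, true)
      have h2 := hlarge (i, false)
      simp only [H, Sum.elim_inl] at h1 h2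
      rw [re_trace_blochMatrix_mul X _ _ hρ] at h1 h2
      simp only [if_true, Pi.single_apply, ite_mul, zero_mul, Finset.sum_ite_eq',
        Finset.mem_univ, Bool.false_eq_true, if_false, one_mul, neg_one_mul] at h1 h2
      have h3 : d * (1 / d) = 1 := by field_simp
      rw [abs_le]
      constructor <;> nlinarith
    obtain ⟨g, hg⟩ := exists_nearGrid (N := N) (by omega) hR hw
    refine ⟨Sum.inr g, ?_⟩
    simp only [H, Sum.elim_inr]
    rw [re_trace_blochMatrix_mul X _ _ hρ]
    have h1 : ∑ i, (gridPoint N (g.1 i) - w i) * (d * (X i * ρ).trace.re) ≤ 1 / 2 :=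
      calc _ ≤ ∑ _i : Fin n, 1 / (N : ℝ) := by
            refine Finset.sum_le_sum fun i _ => (le_abs_self _).trans ?_
            rw [abs_mul]
            exact (mul_le_mul (hg i) (hx i) (abs_nonneg _) (by positivity)).trans_eq (mul_one _)
        _ = n / N := by simp [div_eq_mul_inv]
        _ ≤ 1 / 2 := by
            rw [div_le_div_iff₀ hN0 (by norm_num), hNR]; linarith
    have h2 : ∑ i, d * gridPoint N (g.1 i) * (X i * ρ).trace.re =
        ∑ i, (gridPoint N (g.1 i) - w i) * (d * (X i * ρ).trace.re) +
          d * ∑ i, w i * (X i * ρ).trace.re := by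
      rw [Finset.mul_sum, ← Finset.sum_add_distrib]
      exact Finset.sum_congr rfl fun i _ => by ring
    rw [h2]
    linarith

end Bounds

/-! ### The bounds on the detection capability -/

section Tradeoff

variable {a b k : ℕ}

/-- The net has at most `n ≤ M - 1` dimensions, which leaves the factor `2` as slack. -/
theorem detectionCapability_lt {M : ℕ} (ha : 1 ≤ a) (hb : 1 ≤ b) (hk : 1 ≤ k) (hM : 1 ≤ M)
    {O : Fin (M - 1) → Matrix (Fin a × Fin b) (Fin a × Fin b) ℂ}
    (hO : ∀ i, (O i).IsHermitian) {ε : ℝ} (hε : 0 < ε) (hε1 : ε < 1) :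
    detectionCapability k O <
      2 * Real.exp ((M : ℝ) * Real.log (2 * √(M : ℝ) * ((a : ℝ) * (b : ℝ)) / ε)
        - (√(2 - ε) - 1) ^ 2 * (k : ℝ)) := by
  obtain ⟨n, hn, hle⟩ := exists_detectionCapability_le_pow_mul_exp ha hb hk hO hε hε1
  have hd : (1 : ℝ) ≤ (a : ℝ) * b := by exact_mod_cast Nat.mul_le_mul ha hb
  have hM1 : (1 : ℝ) ≤ √(M : ℝ) := Real.one_le_sqrt.2 (by exact_mod_cast hM)
  have hnM : (n + 1 : ℝ) ≤ M := by
    have : n + 1 ≤ M := by omega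
    exact_mod_cast this
  set B : ℝ := 2 * √(M : ℝ) * ((a : ℝ) * (b : ℝ)) / ε with hB
  have hB1 : 1 ≤ B := by
    rw [hB, le_div_iff₀ hε]
    nlinarith [mul_le_mul hM1 hd zero_le_one (by positivity)]
  have hpow : (2 * √(n + 1 : ℝ) * ((a : ℝ) * b) / ε) ^ n ≤ B ^ M :=
    calc _ ≤ B ^ n := by rw [hB]; gcongr
      _ ≤ B ^ M := pow_le_pow_right₀ hB1 (by omega)
  rw [sub_eq_add_neg, Real.exp_add, Real.exp_nat_mul, Real.exp_log (by linarith), ← neg_mul]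
  have hpos : 0 < B ^ M * Real.exp (-(√(2 - ε) - 1) ^ 2 * k) := by positivity
  have := hle.trans (mul_le_mul_of_nonneg_right hpow (Real.exp_pos _).le)
  linarith

/-- With fewer than `c k / ln k` observables the number `(2 m + 1) ^ (m + 1)` of union bound terms is
at most `exp (γ k / 2)`, where `γ` is the rate of the tail bound. -/
theorem exists_tradeoff : ∃ c c' : ℝ, 0 < c ∧ 0 < c' ∧ ∃ k₀ : ℕ, 2 ≤ k₀ ∧
    ∀ (a b k m : ℕ), 1 ≤ a → 1 ≤ b → k₀ ≤ k →
    ∀ O : Fin m → Matrix (Fin a × Fin b) (Fin a × Fin b) ℂ, (∀ i, (O i).IsHermitian) →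
      c * ((k : ℝ) / Real.log (k : ℝ)) ≤ (m : ℝ) ∨
        detectionCapability k O ≤ Real.exp (-(c' * (k : ℝ))) := by
  have hγ1 : 1 < √(1 + 1 / 5 : ℝ) := by rw [Real.lt_sqrt zero_le_one]; norm_num
  have hγ2 : √(1 + 1 / 5 : ℝ) ≤ 3 / 2 := by rw [Real.sqrt_le_iff]; norm_num
  obtain ⟨γ, hγ⟩ : ∃ γ, γ = (√(1 + 1 / 5 : ℝ) - 1) ^ 2 := ⟨_, rfl⟩
  have hγ0 : 0 < γ := by rw [hγ]; exact pow_pos (sub_pos.2 hγ1) 2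
  have hγ4 : γ ≤ 1 := by rw [hγ]; nlinarith
  -- For large `k`, `ln k ≤ γ k / 4`.
  have hev := ((Real.isLittleO_log_id_atTop.bound (by positivity : 0 < γ / 4)).natCast_atTop).and
    (Filter.eventually_ge_atTop 3)
  obtain ⟨k₀, hk₀⟩ := Filter.eventually_atTop.1 hev
  refine ⟨γ / 4, γ / 2, by positivity, by positivity, max k₀ 2, le_max_right _ _, ?_⟩
  intro a b k m ha hb hk O hO
  obtain ⟨hlog, hk3⟩ := hk₀ k ((le_max_left _ _).trans hk)
  have hk3' : (3 : ℝ) ≤ k := by exact_mod_cast hk3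
  have hlog1 : 1 ≤ Real.log k := by
    rw [Real.le_log_iff_exp_le (by linarith)]
    exact (Real.exp_one_lt_d9.le.trans (by norm_num)).trans hk3'
  rw [id, Real.norm_of_nonneg (by linarith), Real.norm_of_nonneg (by linarith)] at hlog
  rw [or_iff_not_imp_left, not_le]
  intro hm
  have hmlog : m * Real.log k < γ / 4 * k := by
    rwa [← mul_div_assoc, lt_div_iff₀ (by linarith)] at hm
  have hm0 : (0 : ℝ) ≤ m := Nat.cast_nonneg m
  have h2m : (2 * m + 1 : ℝ) ≤ k := by nlinarith
  refine (detectionCapability_le_dimension_free ha hb (by omega) hO).trans ?_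
  have hpow : (2 * m + 1 : ℝ) ^ (m + 1) ≤ Real.exp (γ / 2 * k) :=
    calc (2 * m + 1 : ℝ) ^ (m + 1) ≤ (k : ℝ) ^ (m + 1) := by gcongr
      _ = Real.exp ((m + 1 : ℕ) * Real.log k) := by
          rw [Real.exp_nat_mul, Real.exp_log (by linarith)]
      _ ≤ _ := by rw [Real.exp_le_exp]; push_cast; linarith
  refine (mul_le_mul_of_nonneg_right hpow (Real.exp_pos _).le).trans_eq ?_
  rw [← Real.exp_add, ← hγ]
  congr 1
  ring

end Tradeoff

theorem theorem4 :
    -- the general bound, for every `0 < ε < 1`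
    (∀ (a b k M : ℕ), 1 ≤ a → 1 ≤ b → 1 ≤ k → 1 ≤ M →
      ∀ O : Fin (M - 1) → Matrix (Fin a × Fin b) (Fin a × Fin b) ℂ, (∀ i, (O i).IsHermitian) →
      ∀ ε : ℝ, 0 < ε → ε < 1 →
        detectionCapability k O <
          2 * Real.exp ((M : ℝ) * Real.log (2 * √(M : ℝ) * ((a : ℝ) * (b : ℝ)) / ε)
            - (√(2 - ε) - 1) ^ 2 * (k : ℝ))) ∧
    -- the bound for `ε = 1 / 2`
    (∀ (a b k M : ℕ), 1 ≤ a → 1 ≤ b → 1 ≤ k → 1 ≤ M →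
      ∀ O : Fin (M - 1) → Matrix (Fin a × Fin b) (Fin a × Fin b) ℂ, (∀ i, (O i).IsHermitian) →
        detectionCapability k O <
          2 * Real.exp ((M : ℝ) * Real.log (4 * √(M : ℝ) * ((a : ℝ) * (b : ℝ)))
            - (√(1.5 : ℝ) - 1) ^ 2 * (k : ℝ))) ∧
    -- the trade-off: `Ω(k / ln k)` observables, or success probability `e^{-Ω(k)}`
    (∃ c c' : ℝ, 0 < c ∧ 0 < c' ∧ ∃ k₀ : ℕ, 2 ≤ k₀ ∧
      ∀ (a b k m : ℕ), 1 ≤ a → 1 ≤ b → k₀ ≤ k →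
      ∀ O : Fin m → Matrix (Fin a × Fin b) (Fin a × Fin b) ℂ, (∀ i, (O i).IsHermitian) →
        c * ((k : ℝ) / Real.log (k : ℝ)) ≤ (m : ℝ) ∨
          detectionCapability k O ≤ Real.exp (-(c' * (k : ℝ)))) := by
  refine ⟨fun a b k M ha hb hk hM O hO ε hε hε1 => detectionCapability_lt ha hb hk hM hO hε hε1,
    fun a b k M ha hb hk hM O hO => ?_, exists_tradeoff⟩
  have h := detectionCapability_lt ha hb hk hM hO (ε := 1 / 2) (by norm_num) (by norm_num)
  rwa [show 2 * √(M : ℝ) * ((a : ℝ) * (b : ℝ)) / (1 / 2) = 4 * √(M : ℝ) * ((a : ℝ) * (b : ℝ)) by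
    ring, show (2 : ℝ) - 1 / 2 = 1.5 by norm_num] at h
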